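/- Let $\mathbb{K}$ be a field. A noncrossing partition is a partition $\pi$ of $[n]=\{1,\dots,n\}$, for some $n\ge 1$, into nonempty blocks, such that there are no blocks $b\ne b'$ of $\pi$, $x,z\in b$ and $y,t\in b'$ with $x<y<z<t$. Let $\mathcal{NCP}$ be the set of noncrossing partitions and let $\mathbb{K}[\mathcal{NCP}]$ be the free commutative algebra generated by $\mathcal{NCP}$, with product $m$, also denoted by $\cdot$. If $Y$ is a nonempty set of blocks of $\pi$, let $\pi_{\mid Y}\in\mathcal{NCP}$ be obtained from $Y$ by relabelling the elements of its blocks by the unique increasing bijection onto $[k]$, where $k$ is their number; put $\pi_{\mid\emptyset}=1$. The nesting order on the blocks of $\pi$ is given by $b\le_\pi b'$ if and only if $b'\subseteq[\min b,\max b]$. A set $J$ of blocks of $\pi$ is an ideal if $b\in J$ and $b\le_\pi b'$ imply $b'\in J$. In this case, if $J'=\bigcup_{b\in J}b$ has the maximal intervals (of integers) $J'_1,\dots,J'_k$, each $J'_i$ is a union of blocks belonging to $J$, and we put $\pi_{\mid_\cdot J}=\prod_{i=1}^{k}\pi_{\mid\{b\in J\,:\,b\subseteq J'_i\}}$, the product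 being taken in $\mathbb{K}[\mathcal{NCP}]$. If $\sim$ is an equivalence relation on the set of blocks of $\pi$, let $\pi/{\sim}$ be the partition of $[n]$ obtained by replacing the blocks of each class of $\sim$ by their union, and let $\pi\mid_\cdot{\sim}=\prod_{c}\pi_{\mid c}$, where $c$ runs over the classes of $\sim$ and the product is taken in $\mathbb{K}[\mathcal{NCP}]$. Let $\Delta,\delta:\mathbb{K}[\mathcal{NCP}]\to\mathbb{K}[\mathcal{NCP}]\otimes\mathbb{K}[\mathcal{NCP}]$ and $\varepsilon_\Delta,\epsilon_\delta:\mathbb{K}[\mathcal{NCP}]\to\mathbb{K}$ be the algebra morphisms such that, for any noncrossing partition $\pi$, $$\Delta(\pi)=\sum_{J\text{ ideal of }\pi}\pi_{\mid\pi\setminus J}\otimes\pi_{\mid_\cdot J},\qquad \delta(\pi)=\sum_{\sim\,:\ \pi/\sim\text{ noncrossing}}\pi/{\sim}\otimes\pi\mid_\cdot{\sim},$$ $\varepsilon_\Delta(\pi)=0$, and $\epsilon_\delta(\pi)=1$ if $\pi$ has exactly one block, $\epsilon_\delta(\pi)=0$ otherwise. Then $(\mathbb{K}[\mathcal{NCP}],m,\Delta,\delta)$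 is a double bialgebra, with counits $\varepsilon_\Delta$ and $\epsilon_\delta$. That is to say: $(\mathbb{K}[\mathcal{NCP}],m,\Delta)$ is a bialgebra with counit $\varepsilon_\Delta$; $(\mathbb{K}[\mathcal{NCP}],m,\delta)$ is a bialgebra with counit $\epsilon_\delta$; for any $x\in\mathbb{K}[\mathcal{NCP}]$, $(\varepsilon_\Delta\otimes\mathrm{Id})\circ\delta(x)=\varepsilon_\Delta(x)1$; and $$(\Delta\otimes\mathrm{Id})\circ\delta=m_{1,3,24}\circ(\delta\otimes\delta)\circ\Delta,$$ where $m_{1,3,24}(a_1\otimes a_2\otimes a_3\otimes a_4)=a_1\otimes a_3\otimes a_2\cdot a_4$. -/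

import Mathlib

open scoped TensorProduct

noncomputable section

/-! ### Noncrossing partitions -/

/-- The set of all points lying in one of the blocks of `P`. -/
def ncGround (P : Finset (Finset ℕ)) : Finset ℕ := P.sup id

/-- `P` is (the set of blocks of) a noncrossing partition of the finite set `S` of integers. -/
structure IsNCPartition (P : Finset (Finset ℕ)) (S : Finset ℕ) : Prop where
  nonempty : ∀ b ∈ P, b.Nonempty
  disjoint : ∀ b ∈ P, ∀ c ∈ P, b ≠ c → Disjoint b c
  union_eq : ncGround P = S
  noncrossing : ∀ b ∈ P, ∀ c ∈ P, b ≠ c → ∀ x ∈ b, ∀ z ∈ b, ∀ y ∈ c, ∀ t ∈ c,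
    ¬(x < y ∧ y < z ∧ z < t)

/-- A noncrossing partition of `[n] = {1, …, n}` for some `n ≥ 1`. The empty partition is
excluded, following the convention that there is no noncrossing partition with zero blocks. -/
@[ext]
structure NCP where
  blocks : Finset (Finset ℕ)
  isNCPartition : ∃ n, 1 ≤ n ∧ IsNCPartition blocks (Finset.Icc 1 n)

/-- The position of `x` in the finite set `S`. On `S` this is the unique increasing bijection
from `S` onto `{1, …, |S|}`. -/
def ncRank (S : Finset ℕ) (x : ℕ) : ℕ := (S.filter (· ≤ x)).card

/-- Relabel the points of a set of blocks by the unique increasing bijection onto `{1, …, k}`. -/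
def ncStd (P : Finset (Finset ℕ)) : Finset (Finset ℕ) :=
  P.image fun b => b.image (ncRank (ncGround P))

theorem mem_ncGround {P : Finset (Finset ℕ)} {x : ℕ} : x ∈ ncGround P ↔ ∃ b ∈ P, x ∈ b := by
  simp [ncGround, Finset.mem_sup]

theorem ncRank_lt {S : Finset ℕ} {x y : ℕ} (hy : y ∈ S) (h : x < y) :
    ncRank S x < ncRank S y := by
  apply Finset.card_lt_card
  refine ⟨fun a ha => ?_, fun hs => ?_⟩
  · simp only [Finset.mem_filter] at ha ⊢
    exact ⟨ha.1, by omega⟩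
  · have : y ∈ S.filter (· ≤ x) := hs (by simp [hy])
    simp at this
    omega

theorem ncRank_lt_iff {S : Finset ℕ} {x y : ℕ} (hx : x ∈ S) (hy : y ∈ S) :
    ncRank S x < ncRank S y ↔ x < y := by
  refine ⟨fun h => ?_, ncRank_lt hy⟩
  by_contra hn
  rcases (Nat.not_lt.mp hn).eq_or_lt with h' | h'
  · subst h'; omega
  · have := ncRank_lt hx h'; omega

theorem ncRank_injOn (S : Finset ℕ) : Set.InjOn (ncRank S) S := by
  intro x hx y hy h
  have h1 := ncRank_lt_iff (S := S) hx hy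
  have h2 := ncRank_lt_iff (S := S) hy hx
  omega

theorem image_ncRank (S : Finset ℕ) : S.image (ncRank S) = Finset.Icc 1 S.card := by
  apply Finset.eq_of_subset_of_card_le
  · intro r hr
    obtain ⟨x, hx, rfl⟩ := Finset.mem_image.mp hr
    rw [Finset.mem_Icc]
    exact ⟨Finset.card_pos.mpr ⟨x, by simp [hx]⟩, Finset.card_le_card (Finset.filter_subset _ _)⟩
  · rw [Finset.card_image_of_injOn (ncRank_injOn S)]
    simp

/-- Relabelling a nonempty noncrossing family of blocks gives a noncrossing partition of some
`[n]`. -/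
theorem isNCPartition_ncStd {P : Finset (Finset ℕ)} (h : IsNCPartition P (ncGround P))
    (hP : P.Nonempty) : ∃ n, 1 ≤ n ∧ IsNCPartition (ncStd P) (Finset.Icc 1 n) := by
  have hS : ∀ b ∈ P, ∀ x ∈ b, x ∈ ncGround P := fun b hb x hx => mem_ncGround.mpr ⟨b, hb, hx⟩
  refine ⟨(ncGround P).card, ?_, ?_, ?_, ?_, ?_⟩
  · obtain ⟨b, hb⟩ := hP
    obtain ⟨x, hx⟩ := h.nonempty b hb
    exact Finset.card_pos.mpr ⟨x, hS b hb x hx⟩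
  · simp only [ncStd, Finset.forall_mem_image]
    exact fun b hb => (h.nonempty b hb).image _
  · simp only [ncStd, Finset.forall_mem_image]
    intro b hb c hc hbc
    have hne : b ≠ c := fun e => hbc (by rw [e])
    rw [Finset.disjoint_left]
    simp only [Finset.forall_mem_image]
    intro x hx hx'
    obtain ⟨y, hy, hxy⟩ := Finset.mem_image.mp hx'
    have := ncRank_injOn _ (hS c hc y hy) (hS b hb x hx) hxy
    subst this
    exact Finset.disjoint_left.mp (h.disjoint b hb c hc hne) hx hy
  · rw [← image_ncRank]
    ext r
    simp only [mem_ncGround, ncStd, Finset.mem_image]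
    constructor
    · rintro ⟨_, ⟨b, hb, rfl⟩, hr⟩
      obtain ⟨x, hx, rfl⟩ := Finset.mem_image.mp hr
      exact ⟨x, ⟨b, hb, hx⟩, rfl⟩
    · rintro ⟨x, ⟨b, hb, hx⟩, rfl⟩
      exact ⟨_, ⟨b, hb, rfl⟩, Finset.mem_image_of_mem _ hx⟩
  · simp only [ncStd, Finset.forall_mem_image]
    intro b hb c hc hbc x hx z hz y hy t ht
    have hne : b ≠ c := fun e => hbc (by rw [e])
    rw [ncRank_lt_iff (hS b hb x hx) (hS c hc y hy), ncRank_lt_iff (hS c hc y hy) (hS b hb z hz),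
      ncRank_lt_iff (hS b hb z hz) (hS c hc t ht)]
    exact h.noncrossing b hb c hc hne x hx z hz y hy t ht

/-! ### The free commutative algebra on noncrossing partitions -/

/-- `K[NCP]`, the free commutative `K`-algebra generated by noncrossing partitions. -/
abbrev NCPAlgebra (K : Type*) [Field K] : Type _ := MvPolynomial NCP K

open Classical in
/-- The element of `K[NCP]` attached to a set `P` of blocks: the generator given by the relabelled
noncrossing partition if `P` is nonempty, and `1` if `P` is empty. (The value `0` is only taken at
sets `P` which are not noncrossing partitions of their ground set.) -/
def ncGen (K : Type*) [Field K] (P : Finset (Finset ℕ)) : NCPAlgebra K :=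
  if hP : P.Nonempty then
    if h : IsNCPartition P (ncGround P) then
      MvPolynomial.X ⟨ncStd P, isNCPartition_ncStd h hP⟩
    else 0
  else 1

/-! ### The coproduct `Δ`: separation of blocks along ideals -/

/-- The nesting order on blocks: `b ≤ c` if and only if `c ⊆ [min b, max b]`. -/
def NestLE (b c : Finset ℕ) : Prop := ∀ x ∈ c, ∃ u ∈ b, ∃ v ∈ b, u ≤ x ∧ x ≤ v

/-- `J` is an ideal of `P`: a set of blocks which is upward closed for the nesting order. -/
def IsNCIdeal (P J : Finset (Finset ℕ)) : Prop :=
  J ⊆ P ∧ ∀ b ∈ J, ∀ c ∈ P, NestLE b c → c ∈ J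

/-- The connected components of a finite set `S` of integers, i.e. its maximal intervals. -/
def ncComponents (S : Finset ℕ) : Finset (Finset ℕ) :=
  S.image fun x => S.filter fun y => Finset.uIcc x y ⊆ S

/-- For a noncrossing partition `P` of `[n]`, a set `J` of blocks is an ideal if and only if each
connected component of its ground set is a union of blocks of `P`. -/
theorem isNCIdeal_iff_components {P J : Finset (Finset ℕ)} {n : ℕ}
    (hP : IsNCPartition P (Finset.Icc 1 n)) (hJ : J ⊆ P) :
    IsNCIdeal P J ↔ ∀ C ∈ ncComponents (ncGround J), ∃ Q ⊆ P, ncGround Q = C := by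
  have uniq : ∀ b ∈ P, ∀ c ∈ P, ∀ x, x ∈ b → x ∈ c → b = c := by
    intro b hb c hc x hxb hxc
    by_contra hne
    exact Finset.disjoint_left.mp (hP.disjoint b hb c hc hne) hxb hxc
  constructor
  · rintro ⟨-, hI⟩ C hC
    obtain ⟨x, hx, rfl⟩ := Finset.mem_image.mp hC
    -- a block of `J` cannot leave a component
    have key : ∀ b ∈ J, ∀ u ∈ b, ∀ v ∈ b, u ≤ v → ∀ k, u ≤ k → k ≤ v → k ∈ ncGround J := by
      intro b hb u hu v hv huv k huk hkv
      have hu' : u ∈ Finset.Icc 1 n := hP.union_eq ▸ mem_ncGround.mpr ⟨b, hJ hb, hu⟩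
      have hv' : v ∈ Finset.Icc 1 n := hP.union_eq ▸ mem_ncGround.mpr ⟨b, hJ hb, hv⟩
      rw [Finset.mem_Icc] at hu' hv'
      have hk : k ∈ ncGround P := by rw [hP.union_eq, Finset.mem_Icc]; omega
      obtain ⟨c, hc, hkc⟩ := mem_ncGround.mp hk
      by_cases hbc : b = c
      · subst hbc; exact mem_ncGround.mpr ⟨b, hb, hkc⟩
      have hku : k ≠ u := fun e => hbc (uniq b (hJ hb) c hc u hu (e ▸ hkc))
      have hkv' : k ≠ v := fun e => hbc (uniq b (hJ hb) c hc v hv (e ▸ hkc))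
      refine mem_ncGround.mpr ⟨c, hI b hb c hc fun y hy => ⟨u, hu, v, hv, ?_, ?_⟩, hkc⟩
      · by_contra hlt
        exact hP.noncrossing c hc b (hJ hb) (Ne.symm hbc) y hy k hkc u hu v hv
          ⟨by omega, by omega, by omega⟩
      · by_contra hlt
        exact hP.noncrossing b (hJ hb) c hc hbc u hu v hv k hkc y hy
          ⟨by omega, by omega, by omega⟩
    refine ⟨J.filter fun b => b ⊆ (ncGround J).filter fun y => Finset.uIcc x y ⊆ ncGround J,
      (Finset.filter_subset _ _).trans hJ, ?_⟩
    ext y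
    constructor
    · intro hy
      obtain ⟨b, hb, hyb⟩ := mem_ncGround.mp hy
      exact (Finset.mem_filter.mp hb).2 hyb
    · intro hy
      obtain ⟨hyJ, hxy⟩ := Finset.mem_filter.mp hy
      obtain ⟨b, hb, hyb⟩ := mem_ncGround.mp hyJ
      refine mem_ncGround.mpr ⟨b, Finset.mem_filter.mpr ⟨hb, fun z hz => ?_⟩, hyb⟩
      refine Finset.mem_filter.mpr ⟨mem_ncGround.mpr ⟨b, hb, hz⟩, fun k hk => ?_⟩
      by_cases hk' : k ∈ Finset.uIcc x y
      · exact hxy hk'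
      rw [Finset.mem_uIcc] at hk hk'
      rcases le_total y z with h | h
      · exact key b hb y hyb z hz h k (by omega) (by omega)
      · exact key b hb z hz y hyb h k (by omega) (by omega)
  · refine fun h => ⟨hJ, fun b hb c hc hbc => ?_⟩
    obtain ⟨x, hx⟩ := hP.nonempty c hc
    obtain ⟨u, hu, v, hv, hux, hxv⟩ := hbc x hx
    have huJ : u ∈ ncGround J := mem_ncGround.mpr ⟨b, hb, hu⟩
    obtain ⟨Q, hQ, hQC⟩ := h _ (Finset.mem_image_of_mem _ huJ)
    have huQ : u ∈ ncGround Q := by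
      rw [hQC]; exact Finset.mem_filter.mpr ⟨huJ, by simpa using huJ⟩
    obtain ⟨b', hb', hub'⟩ := mem_ncGround.mp huQ
    have := uniq b (hJ hb) b' (hQ hb') u hu hub'
    subst this
    have hvQ : v ∈ ncGround Q := mem_ncGround.mpr ⟨b, hb', hv⟩
    rw [hQC] at hvQ
    have hxJ : x ∈ ncGround J := (Finset.mem_filter.mp hvQ).2 (by rw [Finset.mem_uIcc]; omega)
    obtain ⟨c', hc', hxc'⟩ := mem_ncGround.mp hxJ
    rw [uniq c hc c' (hJ hc') x hx hxc']
    exact hc'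

/-- The monomial attached to a set `J` of blocks: the product, over the connected components `C` of
the ground set of `J`, of the restrictions of `J` to `C`. -/
def ncSplit (K : Type*) [Field K] (J : Finset (Finset ℕ)) : NCPAlgebra K :=
  ∏ C ∈ ncComponents (ncGround J), ncGen K (J.filter fun b => b ⊆ C)

open Classical in
/-- `Δ(π)` for a generator `π`: the sum of `π_{|π ∖ J} ⊗ π_{|· J}` over the ideals `J` of `π`. -/
def ncDeltaGen (K : Type*) [Field K] (π : NCP) : NCPAlgebra K ⊗[K] NCPAlgebra K :=
  ∑ J ∈ π.blocks.powerset with IsNCIdeal π.blocks J,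
    ncGen K (π.blocks \ J) ⊗ₜ[K] ncSplit K J

/-- The coproduct `Δ` of `K[NCP]`, extended multiplicatively from the generators. -/
def ncDelta (K : Type*) [Field K] :
    NCPAlgebra K →ₐ[K] NCPAlgebra K ⊗[K] NCPAlgebra K :=
  MvPolynomial.aeval (ncDeltaGen K)

/-- The counit of `Δ`: it sends every noncrossing partition to `0`. -/
def ncDeltaCounit (K : Type*) [Field K] : NCPAlgebra K →ₐ[K] K :=
  MvPolynomial.aeval fun _ => 0

/-! ### The coproduct `δ`: fusion of blocks -/

/-- The fusion `π/∼`: an equivalence `∼` on the set of blocks `P` is given by its partition into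
classes, and each class is replaced by the union of the blocks which it contains. -/
def ncFusion {P : Finset (Finset ℕ)} (r : Finpartition P) : Finset (Finset ℕ) :=
  r.parts.image ncGround

/-- The monomial `π|·∼`: the product over the classes of `∼` of the restrictions of `π` to
these classes. -/
def ncExtract (K : Type*) [Field K] {P : Finset (Finset ℕ)} (r : Finpartition P) :
    NCPAlgebra K :=
  ∏ c ∈ r.parts, ncGen K c

open Classical in
/-- `δ(π)` for a generator `π`: the sum of `π/∼ ⊗ π|·∼` over the equivalences `∼` on the set of
blocks such that `π/∼` is noncrossing. -/
def ncFusionDeltaGen (K : Type*) [Field K] (π : NCP) : NCPAlgebra K ⊗[K] NCPAlgebra K :=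
  ∑ r : Finpartition π.blocks with IsNCPartition (ncFusion r) (ncGround π.blocks),
    ncGen K (ncFusion r) ⊗ₜ[K] ncExtract K r

/-- The coproduct `δ` of `K[NCP]`, extended multiplicatively from the generators. -/
def ncFusionDelta (K : Type*) [Field K] :
    NCPAlgebra K →ₐ[K] NCPAlgebra K ⊗[K] NCPAlgebra K :=
  MvPolynomial.aeval (ncFusionDeltaGen K)

/-- The counit of `δ`: it sends a noncrossing partition to `1` if it has exactly one block, and
to `0` otherwise. -/
def ncFusionCounit (K : Type*) [Field K] : NCPAlgebra K →ₐ[K] K :=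
  MvPolynomial.aeval fun π => if π.blocks.card = 1 then 1 else 0

/-! ### Bialgebras and double bialgebras -/

/-- The algebra maps `Δ` and `ε` make the algebra `B` a bialgebra over `K`, that is to say `Δ` is
coassociative with counit `ε`. -/
structure IsBialgebra {K B : Type*} [CommRing K] [CommRing B] [Algebra K B]
    (Δ : B →ₐ[K] B ⊗[K] B) (ε : B →ₐ[K] K) : Prop where
  coassoc : (Algebra.TensorProduct.assoc K K K B B B).toAlgHom.comp
      ((Algebra.TensorProduct.map Δ (AlgHom.id K B)).comp Δ)
    = (Algebra.TensorProduct.map (AlgHom.id K B) Δ).comp Δ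
  counit_left : (Algebra.TensorProduct.map ε (AlgHom.id K B)).comp Δ
    = (Algebra.TensorProduct.lid K B).symm
  counit_right : (Algebra.TensorProduct.map (AlgHom.id K B) ε).comp Δ
    = (Algebra.TensorProduct.rid K K B).symm

/-- The corresponding structure of Mathlib. -/
abbrev IsBialgebra.toBialgebra {K B : Type*} [CommRing K] [CommRing B] [Algebra K B]
    {Δ : B →ₐ[K] B ⊗[K] B} {ε : B →ₐ[K] K} (h : IsBialgebra Δ ε) : Bialgebra K B :=
  Bialgebra.ofAlgHom Δ ε h.coassoc h.counit_left h.counit_right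

/-- The map `m_{1,3,24} : a₁ ⊗ a₂ ⊗ a₃ ⊗ a₄ ↦ a₁ ⊗ a₃ ⊗ a₂a₄`. -/
def mul1324 (K B : Type*) [CommRing K] [CommRing B] [Algebra K B] :
    (B ⊗[K] B) ⊗[K] (B ⊗[K] B) →ₐ[K] (B ⊗[K] B) ⊗[K] B :=
  (Algebra.TensorProduct.map (AlgHom.id K (B ⊗[K] B)) (Algebra.TensorProduct.lmul' K)).comp
    (Algebra.TensorProduct.tensorTensorTensorComm K K K K B B B B).toAlgHom

theorem mul1324_tmul {K B : Type*} [CommRing K] [CommRing B] [Algebra K B] (a₁ a₂ a₃ a₄ : B) :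
    mul1324 K B ((a₁ ⊗ₜ[K] a₂) ⊗ₜ[K] (a₃ ⊗ₜ[K] a₄)) = (a₁ ⊗ₜ[K] a₃) ⊗ₜ[K] (a₂ * a₄) := by
  simp [mul1324]

/-- `(B, m, Δ, δ)`, with respective counits `εΔ` and `εδ`, is a double bialgebra: both coproducts
give bialgebras, and `(B, m, Δ)` is a bialgebra in the category of right comodules over
`(B, m, δ)`, for the coaction `δ`. -/
structure IsDoubleBialgebra {K B : Type*} [CommRing K] [CommRing B] [Algebra K B]
    (Δ δ : B →ₐ[K] B ⊗[K] B) (εΔ εδ : B →ₐ[K] K) : Prop where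
  bialgebra_left : IsBialgebra Δ εΔ
  bialgebra_right : IsBialgebra δ εδ
  counit_coaction : ∀ x : B,
    Algebra.TensorProduct.lid K B (Algebra.TensorProduct.map εΔ (AlgHom.id K B) (δ x))
      = algebraMap K B (εΔ x)
  cointeraction : (Algebra.TensorProduct.map Δ (AlgHom.id K B)).comp δ
    = (mul1324 K B).comp ((Algebra.TensorProduct.map δ δ).comp Δ)

end

/-! All identities are equalities of algebra morphisms, so they are checked on generators. The
generators are taken to be arbitrary finite families `P` of disjoint nonempty blocks, neither
relabelled nor assumed noncrossing: `ncGen` is invariant under increasing relabelling and vanishes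
on crossing families. Subfamilies and fusions of families are again families, so noncrossing never
has to be tracked.

This needs ideals and connected components for families whose ground set has gaps, and both are
defined relatively to `P`. `J` is convex in `P` if it contains every block of `P` with a point
between two points of one block of `J`; two blocks of `J` are linked if every block of `P` with a
point between them is in `J`. For a noncrossing partition of `[n]` this gives back ideals and
maximal intervals. The formulas for `Δ` and `δ` then hold on all families (`ncDelta_ncGen`,
`ncFusionDelta_ncGen`): if `P` has a crossing, each term of either sum keeps it in one of its
factors, so both sides are zero.

Each axiom about coproducts becomes a reindexing of a double sum. For `Δ`, pairs (`J` convex in `P`,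
`I` convex in `P \ J`) correspond to chains `J ⊆ L` of convex sets by `L = J ∪ I`; a convex subset
of `L` is an independent choice in each component of `L` (`ncDelta_ncMonomial_components`). For `δ`,
both sides are indexed by pairs of partitions `X` refining `Q`: partitioning the fused blocks of `X`
amounts to coarsening it (`fusionSum_fuse`), and partitioning each class of `Q` amounts to refining
it (`ncFusionDelta_ncMonomial`).

For the cointeraction, a partition `X` of `P` with a set `U` of classes corresponds to a set `J` of
blocks with partitions of `P \ J` and of `J`. The point is `isConvexIn_fuse_iff`: the fusion of `U`
is convex in that of `X` exactly when the union `J` of `U` is convex in `P` and each class of `U`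
stays inside one component of `J`. The last condition says that the partition of `J` comes from
partitioning each component separately. In the counit identities at most one term survives. -/

noncomputable section

/-! ### Set partitions -/

/-- `X` is the set of blocks of a partition of the finite set `P`. -/
structure IsSetPartition {α : Type*} (X : Finset (Finset α)) (P : Finset α) : Prop where
  nonempty : ∀ c ∈ X, c.Nonempty
  mem_iff : ∀ a, a ∈ P ↔ ∃ c ∈ X, a ∈ c
  eq_of_mem : ∀ c ∈ X, ∀ d ∈ X, ∀ a ∈ c, a ∈ d → c = d

namespace IsSetPartition

variable {α : Type*} {X Q : Finset (Finset α)} {P : Finset α}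

theorem subset (h : IsSetPartition X P) {c : Finset α} (hc : c ∈ X) : c ⊆ P :=
  fun a ha => (h.mem_iff a).2 ⟨c, hc, ha⟩

theorem exists_mem (h : IsSetPartition X P) {a : α} (ha : a ∈ P) : ∃ c ∈ X, a ∈ c :=
  (h.mem_iff a).1 ha

theorem eq_of_subset (hX : IsSetPartition X P) (hQ : IsSetPartition Q P) {d q q' : Finset α}
    (hd : d ∈ X) (hq : q ∈ Q) (hq' : q' ∈ Q) (h : d ⊆ q) (h' : d ⊆ q') : q = q' := by
  obtain ⟨a, ha⟩ := hX.nonempty d hd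
  exact hQ.eq_of_mem q hq q' hq' a (h ha) (h' ha)

end IsSetPartition

open Classical in
/-- The finite set of partitions of the finite set `P`. -/
def setPartitions {α : Type*} (P : Finset α) : Finset (Finset (Finset α)) :=
  P.powerset.powerset.filter fun X => IsSetPartition X P

theorem mem_setPartitions {α : Type*} {P : Finset α} {X : Finset (Finset α)} :
    X ∈ setPartitions P ↔ IsSetPartition X P := by
  simp only [setPartitions, Finset.mem_filter, Finset.mem_powerset, and_iff_right_iff_imp]
  exact fun h c hc => Finset.mem_powerset.2 (h.subset hc)

/-- Sums over `Finpartition`s are sums over `setPartitions`. -/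
theorem sum_finpartition {α M : Type*} [DecidableEq α] [AddCommMonoid M] (P : Finset α)
    (f : Finset (Finset α) → M) :
    ∑ r : Finpartition P, f r.parts = ∑ X ∈ setPartitions P, f X := by
  refine Finset.sum_bij (fun r _ => r.parts) ?_ ?_ ?_ ?_
  · intro r _
    rw [mem_setPartitions]
    refine ⟨fun c hc => r.nonempty_of_mem_parts hc, fun a => ?_, fun c hc d hd a hac had => ?_⟩
    · constructor
      · intro ha; exact r.exists_mem ha
      · rintro ⟨c, hc, ha⟩; exact r.le hc ha
    · exact r.eq_of_mem_parts hc hd hac had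
  · intro r _ s _ h
    exact Finpartition.ext h
  · intro X hX
    rw [mem_setPartitions] at hX
    refine ⟨⟨X, ?_, ?_, ?_⟩, Finset.mem_univ _, rfl⟩
    · rw [Finset.supIndep_iff_pairwiseDisjoint]
      intro c hc d hd hcd
      rw [Function.onFun, id, id, Finset.disjoint_left]
      exact fun a ha ha' => hcd (hX.eq_of_mem c hc d hd a ha ha')
    · ext a
      simp [Finset.mem_sup, hX.mem_iff]
    · intro h
      exact absurd (hX.nonempty _ h) (by simp)
  · intros; rfl

/-- Refinement of partitions. -/
def Refines {α : Type*} (X Q : Finset (Finset α)) : Prop := ∀ d ∈ X, ∃ q ∈ Q, d ⊆ q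

open Classical in
/-- The partitions of `P` which refine `Q`. -/
def refinements {α : Type*} (P : Finset α) (Q : Finset (Finset α)) : Finset (Finset (Finset α)) :=
  (setPartitions P).filter fun X => Refines X Q

theorem mem_refinements {α : Type*} {P : Finset α} {Q X : Finset (Finset α)} :
    X ∈ refinements P Q ↔ IsSetPartition X P ∧ Refines X Q := by
  simp [refinements, mem_setPartitions]

/-- Transport of partitions along an injection. -/
theorem IsSetPartition.image {α β : Type*} [DecidableEq β] {P : Finset α} {X : Finset (Finset α)}
    (hX : IsSetPartition X P) {f : α → β} (hf : Set.InjOn f P) :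
    IsSetPartition (X.image (Finset.image f)) (P.image f) := by
  refine ⟨?_, fun b => ?_, ?_⟩
  · simp only [Finset.forall_mem_image]
    exact fun c hc => (hX.nonempty c hc).image f
  · simp only [Finset.mem_image]
    constructor
    · rintro ⟨a, ha, rfl⟩
      obtain ⟨c, hc, hac⟩ := hX.exists_mem ha
      exact ⟨_, ⟨c, hc, rfl⟩, Finset.mem_image_of_mem f hac⟩
    · rintro ⟨_, ⟨c, hc, rfl⟩, hb⟩
      obtain ⟨a, ha, rfl⟩ := Finset.mem_image.1 hb
      exact ⟨a, hX.subset hc ha, rfl⟩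
  · simp only [Finset.forall_mem_image]
    intro c hc d hd a ha ha'
    obtain ⟨a', had, haa⟩ := Finset.mem_image.1 ha'
    obtain rfl := hf (hX.subset hd had) (hX.subset hc ha) haa
    rw [hX.eq_of_mem c hc d hd _ ha had]

theorem injOn_image_powerset {α β : Type*} [DecidableEq β] {P : Finset α} {f : α → β}
    (hf : Set.InjOn f P) : Set.InjOn (Finset.image f) {c | c ⊆ P} := by
  intro c hc d hd h
  ext a
  constructor
  · intro ha
    obtain ⟨a', ha', e⟩ := Finset.mem_image.1 (h ▸ Finset.mem_image_of_mem f ha)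
    rwa [← hf (hd ha') (hc ha) e]
  · intro ha
    obtain ⟨a', ha', e⟩ := Finset.mem_image.1 (h ▸ Finset.mem_image_of_mem f ha :
      f a ∈ c.image f)
    rwa [← hf (hc ha') (hd ha) e]

/-! ### Refinements, coarsenings and products of sums over partitions -/

section Restriction

variable {α : Type*} [DecidableEq α]

/-- The blocks of a refinement of `Q` inside a block of `Q` form a partition of it. -/
theorem IsSetPartition.restrict {P : Finset α} {X Q : Finset (Finset α)}
    (hX : IsSetPartition X P) (hQ : IsSetPartition Q P) (h : Refines X Q) {q : Finset α}
    (hq : q ∈ Q) : IsSetPartition (X.filter (· ⊆ q)) q := by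
  refine ⟨fun c hc => hX.nonempty c (Finset.mem_filter.1 hc).1, fun a => ⟨fun ha => ?_, ?_⟩, ?_⟩
  · obtain ⟨d, hd, had⟩ := hX.exists_mem (hQ.subset hq ha)
    obtain ⟨q', hq', hdq⟩ := h d hd
    obtain rfl := hQ.eq_of_mem q hq q' hq' a ha (hdq had)
    exact ⟨d, Finset.mem_filter.2 ⟨hd, hdq⟩, had⟩
  · rintro ⟨c, hc, ha⟩
    exact (Finset.mem_filter.1 hc).2 ha
  · intro c hc d hd
    exact hX.eq_of_mem c (Finset.mem_filter.1 hc).1 d (Finset.mem_filter.1 hd).1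

/-- A product of sums over local data, indexed by disjoint regions, is a sum over global data. -/
theorem prod_sum_glue {ι β M : Type*} [DecidableEq ι] [DecidableEq β] [CommSemiring M]
    (s : Finset ι) (t : ι → Finset (Finset β)) (R : ι → β → Prop) [∀ i, DecidablePred (R i)]
    (A : Finset (Finset β)) (f : ι → Finset β → M)
    (hR : ∀ i ∈ s, ∀ T ∈ t i, ∀ b ∈ T, R i b)
    (hd : ∀ i ∈ s, ∀ T ∈ t i, ∀ b ∈ T, ∀ j ∈ s, R j b → j = i)
    (hA : ∀ T, T ∈ A ↔ (∀ b ∈ T, ∃ i ∈ s, R i b) ∧ ∀ i ∈ s, T.filter (R i) ∈ t i) :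
    ∏ i ∈ s, ∑ T ∈ t i, f i T = ∑ T ∈ A, ∏ i ∈ s, f i (T.filter (R i)) := by
  rw [Finset.prod_sum]
  -- The regions are disjoint, so the union of the local choices, cut by region `i`, returns the
  -- choice made at `i`.
  have key : ∀ p ∈ s.pi t, ∀ i (hi : i ∈ s),
      (s.attach.biUnion fun x => p x.1 x.2).filter (R i) = p i hi := by
    intro p hp i hi
    rw [Finset.mem_pi] at hp
    ext b
    simp only [Finset.mem_filter, Finset.mem_biUnion, Finset.mem_attach, true_and,
      Subtype.exists]
    constructor
    · rintro ⟨⟨j, hj, hb⟩, hRb⟩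
      obtain rfl := hd j hj _ (hp j hj) b hb i hi hRb
      exact hb
    · exact fun hb => ⟨⟨i, hi, hb⟩, hR i hi _ (hp i hi) b hb⟩
  refine Finset.sum_bij' (fun p _ => s.attach.biUnion fun x => p x.1 x.2)
    (fun T _ i _ => T.filter (R i)) ?_ ?_ ?_ ?_ ?_
  · intro p hp
    refine (hA _).2 ⟨fun b hb => ?_, fun i hi => ?_⟩
    · simp only [Finset.mem_biUnion, Finset.mem_attach, true_and, Subtype.exists] at hb
      obtain ⟨i, hi, hb⟩ := hb
      exact ⟨i, hi, hR i hi _ (Finset.mem_pi.1 hp i hi) b hb⟩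
    · rw [key p hp i hi]
      exact Finset.mem_pi.1 hp i hi
  · intro T hT
    exact Finset.mem_pi.2 ((hA T).1 hT).2
  · intro p hp
    funext i hi
    exact key p hp i hi
  · intro T hT
    ext b
    simp only [Finset.mem_filter, Finset.mem_biUnion, Finset.mem_attach, true_and,
      Subtype.exists]
    constructor
    · rintro ⟨i, hi, hb, -⟩; exact hb
    · intro hb
      obtain ⟨i, hi, h⟩ := ((hA T).1 hT).1 b hb
      exact ⟨i, hi, hb, h⟩
  · intro p hp
    rw [← Finset.prod_attach s]
    exact Finset.prod_congr rfl fun x _ => by rw [key p hp x.1 x.2]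

/-- Choosing a partition of each block of `Q` amounts to choosing a refinement of `Q`. -/
theorem prod_sum_setPartitions {M : Type*} [CommSemiring M] {P : Finset α}
    {Q : Finset (Finset α)} (hQ : IsSetPartition Q P) (f : Finset α → Finset (Finset α) → M) :
    ∏ q ∈ Q, ∑ X ∈ setPartitions q, f q X
      = ∑ X ∈ refinements P Q, ∏ q ∈ Q, f q (X.filter (· ⊆ q)) := by
  refine prod_sum_glue Q setPartitions (fun q d => d ⊆ q) _ f ?_ ?_ ?_
  · intro q _ X hX d hd
    exact (mem_setPartitions.1 hX).subset hd
  · intro q hq X hX d hd q' hq' hdq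
    rw [mem_setPartitions] at hX
    obtain ⟨a, ha⟩ := hX.nonempty d hd
    exact hQ.eq_of_mem q' hq' q hq a (hdq ha) (hX.subset hd ha)
  · intro X
    rw [mem_refinements]
    constructor
    · rintro ⟨hX, h⟩
      exact ⟨h, fun q hq => mem_setPartitions.2 (hX.restrict hQ h hq)⟩
    · rintro ⟨h, hX⟩
      simp only [mem_setPartitions] at hX
      refine ⟨⟨fun d hd => ?_, fun a => ⟨fun ha => ?_, ?_⟩, fun c hc d hd a hac had => ?_⟩, h⟩
      · obtain ⟨q, hq, hdq⟩ := h d hd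
        exact (hX q hq).nonempty d (Finset.mem_filter.2 ⟨hd, hdq⟩)
      · obtain ⟨q, hq, haq⟩ := hQ.exists_mem ha
        obtain ⟨d, hd, had⟩ := (hX q hq).exists_mem haq
        exact ⟨d, (Finset.mem_filter.1 hd).1, had⟩
      · rintro ⟨d, hd, had⟩
        obtain ⟨q, hq, hdq⟩ := h d hd
        exact hQ.subset hq (hdq had)
      · obtain ⟨q, hq, hcq⟩ := h c hc
        obtain ⟨q', hq', hdq⟩ := h d hd
        obtain rfl := hQ.eq_of_mem q hq q' hq' a (hcq hac) (hdq had)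
        exact (hX q hq).eq_of_mem c (Finset.mem_filter.2 ⟨hc, hcq⟩) d
          (Finset.mem_filter.2 ⟨hd, hdq⟩) a hac had

/-- Reindexing along the bijection that sends a partition to its image; the inverse takes preimages
of blocks inside `P`. -/
theorem sum_setPartitions_image {β M : Type*} [DecidableEq β] [AddCommMonoid M] {P : Finset α}
    {f : α → β} (hf : Set.InjOn f P) (F : Finset (Finset β) → M) :
    ∑ S ∈ setPartitions (P.image f), F S
      = ∑ X ∈ setPartitions P, F (X.image (Finset.image f)) := by
  symm
  refine Finset.sum_bij (fun X _ => X.image (Finset.image f)) ?_ ?_ ?_ (fun _ _ => rfl)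
  · intro X hX
    exact mem_setPartitions.2 ((mem_setPartitions.1 hX).image hf)
  · intro X hX Y hY h
    -- Injectivity of direct images is used twice: on blocks, then on sets of blocks.
    refine injOn_image_powerset (P := P.powerset) (f := Finset.image f) ?_ ?_ ?_ h
    · intro c hc d hd
      exact injOn_image_powerset hf (by simpa using hc) (by simpa using hd)
    · exact fun c hc => Finset.mem_powerset.2 ((mem_setPartitions.1 hX).subset hc)
    · exact fun c hc => Finset.mem_powerset.2 ((mem_setPartitions.1 hY).subset hc)
  · intro S hS
    rw [mem_setPartitions] at hS
    have hsub : ∀ e ∈ S, (P.filter (f · ∈ e)).image f = e := by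
      intro e he
      ext b
      simp only [Finset.mem_image, Finset.mem_filter]
      constructor
      · rintro ⟨a, ⟨-, h⟩, rfl⟩; exact h
      · intro hb
        obtain ⟨a, ha, rfl⟩ := Finset.mem_image.1 (hS.subset he hb)
        exact ⟨a, ⟨ha, hb⟩, rfl⟩
    refine ⟨S.image fun e => P.filter (f · ∈ e), mem_setPartitions.2 ⟨?_, fun a => ?_, ?_⟩, ?_⟩
    · simp only [Finset.forall_mem_image]
      intro e he
      have := hS.nonempty e he
      rw [← hsub e he] at this
      exact Finset.image_nonempty.1 this
    · constructor
      · intro ha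
        obtain ⟨e, he, hae⟩ := hS.exists_mem (Finset.mem_image_of_mem f ha)
        exact ⟨_, Finset.mem_image_of_mem _ he, by simp [ha, hae]⟩
      · rintro ⟨c, hc, ha⟩
        obtain ⟨e, he, rfl⟩ := Finset.mem_image.1 hc
        exact (Finset.mem_filter.1 ha).1
    · simp only [Finset.forall_mem_image]
      intro e he e' he' a ha ha'
      rw [hS.eq_of_mem e he e' he' (f a) (Finset.mem_filter.1 ha).2 (Finset.mem_filter.1 ha').2]
    · rw [Finset.image_image]
      conv_rhs => rw [← Finset.image_id (s := S)]
      exact Finset.image_congr hsub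

/-- Partitions of the set of blocks of `X` amount to coarsenings of `X`. -/
theorem sum_setPartitions_coarsen {M : Type*} [AddCommMonoid M] {P : Finset α}
    {X : Finset (Finset α)} (hX : IsSetPartition X P) (F : Finset (Finset (Finset α)) → M)
    (A : Finset (Finset (Finset α)))
    (hA : ∀ Q, Q ∈ A ↔ IsSetPartition Q P ∧ Refines X Q) :
    ∑ Y ∈ setPartitions X, F Y
      = ∑ Q ∈ A, F (Q.image fun q => X.filter (· ⊆ q)) := by
  symm
  refine Finset.sum_bij (fun Q _ => Q.image fun q => X.filter (· ⊆ q)) ?_ ?_ ?_ (fun _ _ => rfl)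
  · intro Q hQ
    obtain ⟨hQ, h⟩ := (hA Q).1 hQ
    rw [mem_setPartitions]
    refine ⟨?_, fun d => ⟨fun hd => ?_, ?_⟩, ?_⟩
    · simp only [Finset.forall_mem_image]
      intro q hq
      obtain ⟨a, ha⟩ := hQ.nonempty q hq
      obtain ⟨d, hd, -⟩ := (hX.restrict hQ h hq).exists_mem ha
      exact ⟨d, hd⟩
    · obtain ⟨q, hq, hdq⟩ := h d hd
      exact ⟨_, Finset.mem_image_of_mem _ hq, Finset.mem_filter.2 ⟨hd, hdq⟩⟩
    · rintro ⟨e, he, hd⟩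
      obtain ⟨q, hq, rfl⟩ := Finset.mem_image.1 he
      exact (Finset.mem_filter.1 hd).1
    · simp only [Finset.forall_mem_image, Finset.mem_filter]
      rintro q hq q' hq' d ⟨hd, hdq⟩ ⟨-, hdq'⟩
      rw [hX.eq_of_subset hQ hd hq hq' hdq hdq']
  · intro Q hQ Q' hQ' e
    obtain ⟨hQ, h⟩ := (hA Q).1 hQ
    obtain ⟨hQ', h'⟩ := (hA Q').1 hQ'
    have aux : ∀ {Q Q' : Finset (Finset α)}, IsSetPartition Q P → Refines X Q →
        IsSetPartition Q' P → Refines X Q' →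
        (Q.image fun q => X.filter (· ⊆ q)) = (Q'.image fun q => X.filter (· ⊆ q)) →
        Q ⊆ Q' := by
      intro Q Q' hQ h hQ' h' e q hq
      have hm := Finset.mem_image_of_mem (fun q => X.filter (· ⊆ q)) hq
      rw [e] at hm
      obtain ⟨q', hq', e'⟩ := Finset.mem_image.1 hm
      have : q' = q := by
        ext a
        rw [(hX.restrict hQ h hq).mem_iff, (hX.restrict hQ' h' hq').mem_iff]
        rw [e']
      exact this ▸ hq'
    exact Finset.Subset.antisymm (aux hQ h hQ' h' e) (aux hQ' h' hQ h e.symm)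
  · intro Y hY
    rw [mem_setPartitions] at hY
    -- A class of blocks is recovered from its union because the blocks of `X` are nonempty and
    -- disjoint; hence unions of classes give the inverse map.
    have hfil : ∀ e ∈ Y, X.filter (· ⊆ e.sup id) = e := by
      intro e he
      ext d
      rw [Finset.mem_filter]
      constructor
      · rintro ⟨hd, hde⟩
        obtain ⟨a, ha⟩ := hX.nonempty d hd
        obtain ⟨d', hd', ha'⟩ := Finset.mem_sup.1 (hde ha)
        rwa [hX.eq_of_mem d hd d' (hY.subset he hd') a ha ha']
      · intro hd
        exact ⟨hY.subset he hd, Finset.le_sup (f := id) hd⟩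
    refine ⟨Y.image fun e => e.sup id, (hA _).2 ⟨⟨?_, fun a => ⟨fun ha => ?_, ?_⟩, ?_⟩, ?_⟩, ?_⟩
    · simp only [Finset.forall_mem_image]
      intro e he
      obtain ⟨d, hd⟩ := hY.nonempty e he
      exact (hX.nonempty d (hY.subset he hd)).mono (Finset.le_sup (f := id) hd)
    · obtain ⟨d, hd, had⟩ := hX.exists_mem ha
      obtain ⟨e, he, hde⟩ := hY.exists_mem hd
      exact ⟨_, Finset.mem_image_of_mem _ he, Finset.mem_sup.2 ⟨d, hde, had⟩⟩
    · rintro ⟨q, hq, ha⟩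
      obtain ⟨e, he, rfl⟩ := Finset.mem_image.1 hq
      obtain ⟨d, hd, had⟩ := Finset.mem_sup.1 ha
      exact hX.subset (hY.subset he hd) had
    · simp only [Finset.forall_mem_image]
      intro e he e' he' a ha ha'
      obtain ⟨d, hd, had⟩ := Finset.mem_sup.1 ha
      obtain ⟨d', hd', had'⟩ := Finset.mem_sup.1 ha'
      obtain rfl := hX.eq_of_mem d (hY.subset he hd) d' (hY.subset he' hd') a had had'
      rw [hY.eq_of_mem e he e' he' d hd hd']
    · intro d hd
      obtain ⟨e, he, hde⟩ := hY.exists_mem hd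
      exact ⟨_, Finset.mem_image_of_mem _ he, Finset.le_sup (f := id) hde⟩
    · rw [Finset.image_image]
      conv_rhs => rw [← Finset.image_id (s := Y)]
      exact Finset.image_congr hfil

end Restriction

/-! ### Families of disjoint blocks -/

/-- `P` is a family of pairwise disjoint nonempty blocks. -/
def IsBlockFamily (P : Finset (Finset ℕ)) : Prop := IsSetPartition P (ncGround P)

theorem isBlockFamily_iff {P : Finset (Finset ℕ)} : IsBlockFamily P ↔
    (∀ c ∈ P, c.Nonempty) ∧ ∀ c ∈ P, ∀ d ∈ P, ∀ a ∈ c, a ∈ d → c = d :=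
  ⟨fun h => ⟨h.nonempty, h.eq_of_mem⟩, fun h => ⟨h.1, fun _ => mem_ncGround, h.2⟩⟩

theorem IsBlockFamily.mono {P Q : Finset (Finset ℕ)} (h : IsBlockFamily P) (hQ : Q ⊆ P) :
    IsBlockFamily Q :=
  isBlockFamily_iff.2 ⟨fun c hc => h.nonempty c (hQ hc),
    fun c hc d hd => h.eq_of_mem c (hQ hc) d (hQ hd)⟩

theorem IsNCPartition.isBlockFamily {P : Finset (Finset ℕ)} {S : Finset ℕ}
    (h : IsNCPartition P S) : IsBlockFamily P := by
  refine isBlockFamily_iff.2 ⟨h.nonempty, fun c hc d hd a hac had => ?_⟩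
  by_contra hne
  exact Finset.disjoint_left.mp (h.disjoint c hc d hd hne) hac had

theorem IsBlockFamily.isNCPartition_iff {P : Finset (Finset ℕ)} (h : IsBlockFamily P) :
    IsNCPartition P (ncGround P) ↔ ∀ b ∈ P, ∀ c ∈ P, b ≠ c → ∀ x ∈ b, ∀ z ∈ b, ∀ y ∈ c,
      ∀ t ∈ c, ¬(x < y ∧ y < z ∧ z < t) := by
  refine ⟨fun hP => hP.noncrossing, fun hP => ⟨h.nonempty, fun b hb c hc hbc => ?_, rfl, hP⟩⟩
  rw [Finset.disjoint_left]
  exact fun a hab hac => hbc (h.eq_of_mem b hb c hc a hab hac)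

theorem subset_ncGround {P : Finset (Finset ℕ)} {b : Finset ℕ} (hb : b ∈ P) : b ⊆ ncGround P :=
  fun _ hx => mem_ncGround.2 ⟨b, hb, hx⟩

/-! ### Relabelling -/

section Relabel

variable {P : Finset (Finset ℕ)} {φ : ℕ → ℕ}

theorem ncGround_image : ncGround (P.image (Finset.image φ)) = (ncGround P).image φ := by
  ext x
  simp only [mem_ncGround, Finset.mem_image]
  constructor
  · rintro ⟨_, ⟨b, hb, rfl⟩, hx⟩
    obtain ⟨a, ha, rfl⟩ := Finset.mem_image.1 hx
    exact ⟨a, ⟨b, hb, ha⟩, rfl⟩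
  · rintro ⟨a, ⟨b, hb, ha⟩, rfl⟩
    exact ⟨_, ⟨b, hb, rfl⟩, Finset.mem_image_of_mem _ ha⟩

theorem injOn_image_blocks (hφ : Set.InjOn φ (ncGround P)) :
    Set.InjOn (Finset.image φ) (P : Set (Finset ℕ)) :=
  (injOn_image_powerset hφ).mono fun _ hb => subset_ncGround hb

/-- The rank only counts smaller or equal elements, which an increasing map preserves. All
invariance under relabelling rests on this. -/
theorem ncRank_image {S : Finset ℕ} (hφ : StrictMonoOn φ S) {x : ℕ} (hx : x ∈ S) :
    ncRank (S.image φ) (φ x) = ncRank S x := by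
  have : (S.image φ).filter (· ≤ φ x) = (S.filter (· ≤ x)).image φ := by
    rw [Finset.filter_image]
    congr 1
    exact Finset.filter_congr fun y hy => hφ.le_iff_le hy hx
  rw [ncRank, this, Finset.card_image_of_injOn]
  · rfl
  · exact hφ.injOn.mono (Finset.coe_subset.2 (Finset.filter_subset _ _))

theorem ncStd_image (hφ : StrictMonoOn φ (ncGround P)) :
    ncStd (P.image (Finset.image φ)) = ncStd P := by
  rw [ncStd, ncStd, Finset.image_image, ncGround_image]
  refine Finset.image_congr fun b hb => ?_
  simp only [Function.comp, Finset.image_image]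
  exact Finset.image_congr fun x hx => ncRank_image hφ (subset_ncGround hb hx)

theorem isNCPartition_image_iff (hφ : StrictMonoOn φ (ncGround P)) :
    IsNCPartition (P.image (Finset.image φ)) (ncGround (P.image (Finset.image φ))) ↔
      IsNCPartition P (ncGround P) := by
  have hS : ∀ b ∈ P, ∀ x ∈ b, x ∈ (ncGround P : Set ℕ) := fun b hb x hx => subset_ncGround hb hx
  have hinj := injOn_image_blocks hφ.injOn
  constructor
  · intro h
    refine ⟨fun b hb => ?_, fun b hb c hc hbc => ?_, rfl, fun b hb c hc hbc x hx z hz y hy t ht => ?_⟩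
    · exact Finset.image_nonempty.1 (h.nonempty _ (Finset.mem_image_of_mem _ hb))
    · have := h.disjoint _ (Finset.mem_image_of_mem _ hb) _ (Finset.mem_image_of_mem _ hc)
        (fun e => hbc (hinj hb hc e))
      rw [Finset.disjoint_left] at this ⊢
      exact fun a ha ha' => this (Finset.mem_image_of_mem _ ha) (Finset.mem_image_of_mem _ ha')
    · have := h.noncrossing _ (Finset.mem_image_of_mem _ hb) _ (Finset.mem_image_of_mem _ hc)
        (fun e => hbc (hinj hb hc e)) _ (Finset.mem_image_of_mem _ hx) _
        (Finset.mem_image_of_mem _ hz) _ (Finset.mem_image_of_mem _ hy) _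
        (Finset.mem_image_of_mem _ ht)
      rwa [hφ.lt_iff_lt (hS b hb x hx) (hS c hc y hy), hφ.lt_iff_lt (hS c hc y hy) (hS b hb z hz),
        hφ.lt_iff_lt (hS b hb z hz) (hS c hc t ht)] at this
  · intro h
    refine ⟨?_, ?_, rfl, ?_⟩
    · simp only [Finset.forall_mem_image]
      exact fun b hb => (h.nonempty b hb).image _
    · simp only [Finset.forall_mem_image]
      intro b hb c hc hbc
      have hne : b ≠ c := fun e => hbc (by rw [e])
      rw [Finset.disjoint_left]
      simp only [Finset.forall_mem_image]
      intro x hx hx'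
      obtain ⟨y, hy, hxy⟩ := Finset.mem_image.mp hx'
      obtain rfl := hφ.injOn (hS c hc y hy) (hS b hb x hx) hxy
      exact Finset.disjoint_left.mp (h.disjoint b hb c hc hne) hx hy
    · simp only [Finset.forall_mem_image]
      intro b hb c hc hbc x hx z hz y hy t ht
      have hne : b ≠ c := fun e => hbc (by rw [e])
      rw [hφ.lt_iff_lt (hS b hb x hx) (hS c hc y hy), hφ.lt_iff_lt (hS c hc y hy) (hS b hb z hz),
        hφ.lt_iff_lt (hS b hb z hz) (hS c hc t ht)]
      exact h.noncrossing b hb c hc hne x hx z hz y hy t ht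

end Relabel

theorem strictMonoOn_ncRank (S : Finset ℕ) : StrictMonoOn (ncRank S) S :=
  fun _ _ _ hy h => ncRank_lt hy h

/-! ### Generators attached to families of blocks -/

section Gen

variable (K : Type*) [Field K]

@[simp]
theorem ncGen_empty : ncGen K ∅ = 1 := by simp [ncGen]

theorem isNCPartition_empty : IsNCPartition ∅ (ncGround ∅) :=
  ⟨by simp, by simp, rfl, by simp⟩

/-- This default value allows sums to range over all families, crossing ones included. -/
theorem ncGen_eq_zero {P : Finset (Finset ℕ)} (h : ¬IsNCPartition P (ncGround P)) :
    ncGen K P = 0 := by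
  have : P.Nonempty := by
    rw [Finset.nonempty_iff_ne_empty]
    rintro rfl
    exact h isNCPartition_empty
  simp [ncGen, this, h]

theorem ncGen_eq_X {P : Finset (Finset ℕ)} (h : IsNCPartition P (ncGround P))
    (hP : P.Nonempty) : ncGen K P = MvPolynomial.X ⟨ncStd P, isNCPartition_ncStd h hP⟩ := by
  simp [ncGen, hP, h]

theorem ncGen_image {P : Finset (Finset ℕ)} {φ : ℕ → ℕ} (hφ : StrictMonoOn φ (ncGround P)) :
    ncGen K (P.image (Finset.image φ)) = ncGen K P := by
  rcases P.eq_empty_or_nonempty with rfl | hP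
  · simp
  · by_cases h : IsNCPartition P (ncGround P)
    · rw [ncGen_eq_X K h hP, ncGen_eq_X K ((isNCPartition_image_iff hφ).2 h) (hP.image _)]
      congr 1
      ext1
      exact ncStd_image hφ
    · rw [ncGen_eq_zero K h, ncGen_eq_zero K (mt (isNCPartition_image_iff hφ).1 h)]

theorem NCP.isNCPartition_blocks (π : NCP) : IsNCPartition π.blocks (ncGround π.blocks) := by
  obtain ⟨n, -, h⟩ := π.isNCPartition
  rwa [h.union_eq]

theorem NCP.blocks_nonempty (π : NCP) : π.blocks.Nonempty := by
  obtain ⟨n, hn, h⟩ := π.isNCPartition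
  have : 1 ∈ ncGround π.blocks := by rw [h.union_eq]; simp [hn]
  obtain ⟨b, hb, -⟩ := mem_ncGround.1 this
  exact ⟨b, hb⟩

theorem ncRank_Icc {n x : ℕ} (hx : x ∈ Finset.Icc 1 n) : ncRank (Finset.Icc 1 n) x = x := by
  have : (Finset.Icc 1 n).filter (· ≤ x) = Finset.Icc 1 x := by
    ext y
    simp only [Finset.mem_filter, Finset.mem_Icc] at hx ⊢
    omega
  rw [ncRank, this]
  simp

theorem NCP.ncStd_blocks (π : NCP) : ncStd π.blocks = π.blocks := by
  obtain ⟨n, -, h⟩ := π.isNCPartition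
  rw [ncStd]
  conv_rhs => rw [← Finset.image_id (s := π.blocks)]
  refine Finset.image_congr fun b hb => ?_
  simp only [id]
  conv_rhs => rw [← Finset.image_id (s := b)]
  refine Finset.image_congr fun x hx => ?_
  have hx' := subset_ncGround hb hx
  rw [h.union_eq] at hx' ⊢
  exact ncRank_Icc hx'

theorem ncGen_blocks (π : NCP) : ncGen K π.blocks = MvPolynomial.X π := by
  rw [ncGen_eq_X K π.isNCPartition_blocks π.blocks_nonempty]
  congr 1
  ext1
  exact π.ncStd_blocks

/-- The monomial attached to a set of families of blocks. -/
def ncMonomial (X : Finset (Finset (Finset ℕ))) : NCPAlgebra K := ∏ c ∈ X, ncGen K c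

/-- Entry point of every axiom: since `ncGen_blocks` writes each generator as `ncGen` of its own
blocks, the computations can be done on families. -/
theorem algHom_ext_ncGen {B : Type*} [Semiring B] [Algebra K B] {f g : NCPAlgebra K →ₐ[K] B}
    (h : ∀ P, IsNCPartition P (ncGround P) → P.Nonempty → f (ncGen K P) = g (ncGen K P)) :
    f = g := by
  refine MvPolynomial.algHom_ext fun π => ?_
  rw [← ncGen_blocks]
  exact h _ π.isNCPartition_blocks π.blocks_nonempty

end Gen

/-! ### Convex sets of blocks and their connected components -/

/-- All the blocks of `P` with a point between a point of `b` and a point of `b'` are in `J`. -/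
def Linked (P J : Finset (Finset ℕ)) (b b' : Finset ℕ) : Prop :=
  ∀ x ∈ b, ∀ y ∈ b', ∀ c ∈ P, ∀ z ∈ c, z ∈ Finset.uIcc x y → c ∈ J

/-- `J` contains all blocks of `P` having a point between two points of a block of `J`. -/
def IsConvexIn (P J : Finset (Finset ℕ)) : Prop := J ⊆ P ∧ ∀ b ∈ J, Linked P J b b

open Classical in
/-- The finite set of convex subsets of `P`. -/
def convexSubsets (P : Finset (Finset ℕ)) : Finset (Finset (Finset ℕ)) :=
  P.powerset.filter (IsConvexIn P)

theorem mem_convexSubsets {P J : Finset (Finset ℕ)} : J ∈ convexSubsets P ↔ IsConvexIn P J := by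
  simp only [convexSubsets, Finset.mem_filter, Finset.mem_powerset, and_iff_right_iff_imp]
  exact fun h => h.1

open Classical in
/-- The sets of blocks of `J` lying in the same connected component relatively to `P`. -/
def components (P J : Finset (Finset ℕ)) : Finset (Finset (Finset ℕ)) :=
  J.image fun b => J.filter (Linked P J b)

theorem Linked.symm {P J : Finset (Finset ℕ)} {b b' : Finset ℕ} (h : Linked P J b b') :
    Linked P J b' b :=
  fun x hx y hy c hc z hz hzz => h y hy x hx c hc z hz (by rwa [Finset.uIcc_comm])

/-- For any `w` in the middle block, a point between `x` and `y` is between `x` and `w` or between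
`w` and `y`. -/
theorem Linked.trans {P J : Finset (Finset ℕ)} {b b' b'' : Finset ℕ} (h : Linked P J b b')
    (h' : Linked P J b' b'') (hb : b'.Nonempty) : Linked P J b b'' := by
  intro x hx y hy c hc z hz hzz
  obtain ⟨w, hw⟩ := hb
  rw [Finset.mem_uIcc] at hzz
  by_cases hxw : z ∈ Finset.uIcc x w
  · exact h x hx w hw c hc z hz hxw
  · refine h' w hw y hy c hc z hz ?_
    rw [Finset.mem_uIcc] at hxw ⊢
    omega

theorem mem_components {P J : Finset (Finset ℕ)} {c : Finset (Finset ℕ)} :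
    c ∈ components P J ↔ ∃ b ∈ J, ∀ b', b' ∈ c ↔ b' ∈ J ∧ Linked P J b b' := by
  simp only [components, Finset.mem_image, Finset.ext_iff, Finset.mem_filter]
  exact ⟨fun ⟨b, hb, h⟩ => ⟨b, hb, fun b' => (h b').symm⟩,
    fun ⟨b, hb, h⟩ => ⟨b, hb, fun b' => (h b').symm⟩⟩

theorem linked_of_mem_components {P J c : Finset (Finset ℕ)} {b b' : Finset ℕ}
    (hP : IsBlockFamily P) (hJ : J ⊆ P) (hc : c ∈ components P J) (hb : b ∈ c) (hb' : b' ∈ c) :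
    Linked P J b b' := by
  obtain ⟨a, ha, h⟩ := mem_components.1 hc
  exact ((h b).1 hb).2.symm.trans ((h b').1 hb').2 (hP.nonempty a (hJ ha))

theorem mem_of_linked {P J c : Finset (Finset ℕ)} {b b' : Finset ℕ}
    (hP : IsBlockFamily P) (hJ : J ⊆ P) (hc : c ∈ components P J) (hb : b ∈ c) (hb' : b' ∈ J)
    (hl : Linked P J b b') : b' ∈ c := by
  obtain ⟨a, ha, h⟩ := mem_components.1 hc
  exact (h b').2 ⟨hb', ((h b).1 hb).2.trans hl (hP.nonempty b (hJ ((h b).1 hb).1))⟩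

/-- On a convex set, being linked is an equivalence relation: convexity is precisely its
reflexivity. -/
theorem isSetPartition_components {P J : Finset (Finset ℕ)} (hP : IsBlockFamily P)
    (hJ : IsConvexIn P J) : IsSetPartition (components P J) J := by
  classical
  refine ⟨?_, fun b => ⟨fun hb => ⟨_, Finset.mem_image_of_mem _ hb, ?_⟩, ?_⟩, ?_⟩
  · simp only [components, Finset.forall_mem_image]
    exact fun b hb => ⟨b, Finset.mem_filter.2 ⟨hb, hJ.2 b hb⟩⟩
  · exact Finset.mem_filter.2 ⟨hb, hJ.2 b hb⟩
  · rintro ⟨c, hc, hb⟩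
    obtain ⟨a, ha, h⟩ := mem_components.1 hc
    exact ((h b).1 hb).1
  · intro c hc d hd b hbc hbd
    obtain ⟨a, ha, h⟩ := mem_components.1 hc
    obtain ⟨a', ha', h'⟩ := mem_components.1 hd
    ext e
    constructor
    · intro he
      exact mem_of_linked hP hJ.1 hd hbd ((h e).1 he).1
        (linked_of_mem_components hP hJ.1 hc hbc he)
    · intro he
      exact mem_of_linked hP hJ.1 hc hbc ((h' e).1 he).1
        (linked_of_mem_components hP hJ.1 hd hbd he)

/-- A set of families of blocks refines the components if and only if it only gathers linked
blocks. -/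
theorem refines_components_iff {P J : Finset (Finset ℕ)} {Z : Finset (Finset (Finset ℕ))}
    (hP : IsBlockFamily P) (hJ : J ⊆ P) (hZ : IsSetPartition Z J) :
    (IsConvexIn P J ∧ Refines Z (components P J)) ↔
      ∀ e ∈ Z, ∀ b ∈ e, ∀ b' ∈ e, Linked P J b b' := by
  classical
  constructor
  · rintro ⟨hJ', h⟩ e he b hb b' hb'
    obtain ⟨c, hc, hec⟩ := h e he
    exact linked_of_mem_components hP hJ hc (hec hb) (hec hb')
  · refine fun h => ⟨⟨hJ, fun b hb => ?_⟩, fun e he => ?_⟩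
    · obtain ⟨e, he, hbe⟩ := hZ.exists_mem hb
      exact h e he b hbe b hbe
    · obtain ⟨b, hb⟩ := hZ.nonempty e he
      refine ⟨_, Finset.mem_image_of_mem _ (hZ.subset he hb), fun b' hb' => ?_⟩
      exact Finset.mem_filter.2 ⟨hZ.subset he hb', h e he b hb b' hb'⟩

/-! ### Transport of convex sets -/

section Transport

variable {P J : Finset (Finset ℕ)} {φ : ℕ → ℕ}

theorem linked_image_iff (hφ : StrictMonoOn φ (ncGround P)) (hJ : J ⊆ P) {b b' : Finset ℕ}
    (hb : b ∈ P) (hb' : b' ∈ P) :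
    Linked (P.image (Finset.image φ)) (J.image (Finset.image φ)) (b.image φ) (b'.image φ) ↔
      Linked P J b b' := by
  have hS : ∀ b ∈ P, ∀ x ∈ b, x ∈ (ncGround P : Set ℕ) := fun b hb x hx => subset_ncGround hb hx
  have hinj := injOn_image_blocks hφ.injOn
  simp only [Linked, Finset.forall_mem_image]
  refine forall₂_congr fun x hx => forall₂_congr fun y hy => forall₂_congr fun c hc =>
    forall₂_congr fun z hz => ?_
  have h1 := hφ.le_iff_le (hS b hb x hx) (hS c hc z hz)
  have h2 := hφ.le_iff_le (hS c hc z hz) (hS b' hb' y hy)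
  have h3 := hφ.le_iff_le (hS b' hb' y hy) (hS c hc z hz)
  have h4 := hφ.le_iff_le (hS c hc z hz) (hS b hb x hx)
  rw [Finset.mem_uIcc', Finset.mem_uIcc', h1, h2, h3, h4]
  refine imp_congr_right fun _ => ⟨fun h => ?_, fun h => Finset.mem_image_of_mem _ h⟩
  obtain ⟨d, hd, e⟩ := Finset.mem_image.1 h
  rwa [← hinj (hJ hd) hc e]

theorem isConvexIn_image_iff (hφ : StrictMonoOn φ (ncGround P)) (hJ : J ⊆ P) :
    IsConvexIn (P.image (Finset.image φ)) (J.image (Finset.image φ)) ↔ IsConvexIn P J := by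
  simp only [IsConvexIn, Finset.forall_mem_image, hJ, Finset.image_subset_image hJ, true_and]
  exact forall₂_congr fun b hb => linked_image_iff hφ hJ (hJ hb) (hJ hb)

theorem components_image (hφ : StrictMonoOn φ (ncGround P)) (hJ : J ⊆ P) :
    components (P.image (Finset.image φ)) (J.image (Finset.image φ))
      = (components P J).image (Finset.image (Finset.image φ)) := by
  classical
  rw [components, components, Finset.image_image, Finset.image_image]
  refine Finset.image_congr fun b hb => ?_
  simp only [Function.comp]
  rw [Finset.filter_image]
  congr 1
  exact Finset.filter_congr fun b' hb' => linked_image_iff hφ hJ (hJ hb) (hJ hb')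

theorem sum_convexSubsets_image {M : Type*} [AddCommMonoid M]
    (hφ : StrictMonoOn φ (ncGround P)) (F : Finset (Finset ℕ) → M) :
    ∑ J ∈ convexSubsets (P.image (Finset.image φ)), F J
      = ∑ J ∈ convexSubsets P, F (J.image (Finset.image φ)) := by
  symm
  refine Finset.sum_bij (fun J _ => J.image (Finset.image φ)) ?_ ?_ ?_ (fun _ _ => rfl)
  · intro J hJ
    rw [mem_convexSubsets] at hJ ⊢
    exact (isConvexIn_image_iff hφ hJ.1).2 hJ
  · intro J hJ I hI h
    exact injOn_image_powerset (injOn_image_blocks hφ.injOn) (mem_convexSubsets.1 hJ).1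
      (mem_convexSubsets.1 hI).1 h
  · intro J' hJ'
    rw [mem_convexSubsets] at hJ'
    obtain ⟨J, hJ, rfl⟩ := Finset.subset_image_iff.1 hJ'.1
    exact ⟨J, mem_convexSubsets.2 ((isConvexIn_image_iff hφ hJ).1 hJ'), rfl⟩

theorem ncGround_mono {Q : Finset (Finset ℕ)} (h : Q ⊆ P) : ncGround Q ⊆ ncGround P :=
  Finset.sup_mono h

theorem ncMonomial_image (K : Type*) [Field K] {X : Finset (Finset (Finset ℕ))}
    (hφ : StrictMonoOn φ (ncGround P)) (hX : ∀ c ∈ X, c ⊆ P) :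
    ncMonomial K (X.image (Finset.image (Finset.image φ))) = ncMonomial K X := by
  rw [ncMonomial, Finset.prod_image]
  · exact Finset.prod_congr rfl fun c hc =>
      ncGen_image K (hφ.mono (Finset.coe_subset.2 (ncGround_mono (hX c hc))))
  · intro c hc d hd h
    exact injOn_image_powerset (injOn_image_blocks hφ.injOn) (hX c hc) (hX d hd) h

end Transport

/-! ### The coproduct by separation on families of blocks -/

/-- In a noncrossing family, another block with one point between two points of `b` lies entirely
between them, so it is nested under `b`. -/
theorem isNCIdeal_iff_isConvexIn {P J : Finset (Finset ℕ)}
    (hP : IsNCPartition P (ncGround P)) : IsNCIdeal P J ↔ IsConvexIn P J := by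
  refine and_congr_right fun hJ => ⟨fun h b hb x hx y hy c hc z hz hzz => ?_,
    fun h b hb c hc hbc => ?_⟩
  · by_cases hbc : b = c
    · exact hbc ▸ hb
    have key : ∀ u ∈ b, ∀ v ∈ b, u ≤ z → z ≤ v → c ∈ J := by
      intro u hu v hv huz hzv
      have hku : z ≠ u := fun e => hbc (hP.isBlockFamily.eq_of_mem b (hJ hb) c hc u hu (e ▸ hz))
      have hkv : z ≠ v := fun e => hbc (hP.isBlockFamily.eq_of_mem b (hJ hb) c hc v hv (e ▸ hz))
      refine h b hb c hc fun t ht => ⟨u, hu, v, hv, ?_, ?_⟩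
      · by_contra hlt
        exact hP.noncrossing c hc b (hJ hb) (Ne.symm hbc) t ht z hz u hu v hv
          ⟨by omega, by omega, by omega⟩
      · by_contra hlt
        exact hP.noncrossing b (hJ hb) c hc hbc u hu v hv z hz t ht
          ⟨by omega, by omega, by omega⟩
    rw [Finset.mem_uIcc'] at hzz
    rcases hzz with h' | h'
    · exact key x hx y hy h'.1 h'.2
    · exact key y hy x hx h'.1 h'.2
  · obtain ⟨x, hx⟩ := hP.nonempty c hc
    obtain ⟨u, hu, v, hv, hux, hxv⟩ := hbc x hx
    exact h b hb u hu v hv c hc x hx (by rw [Finset.mem_uIcc]; omega)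

/-- Two blocks of a convex set are linked as soon as two of their points are. -/
theorem IsConvexIn.linked_of_points {P J : Finset (Finset ℕ)} (hJ : IsConvexIn P J)
    {b b' : Finset ℕ} (hb : b ∈ J) (hb' : b' ∈ J) {x y : ℕ} (hx : x ∈ b) (hy : y ∈ b')
    (h : ∀ c ∈ P, ∀ z ∈ c, z ∈ Finset.uIcc x y → c ∈ J) : Linked P J b b' := by
  intro x' hx' y' hy' c hc z hz hzz
  -- A point between `x'` and `y'` is between `x'` and `x`, `x` and `y`, or `y` and `y'`; the outer
  -- two cases are convexity.
  by_cases h1 : z ∈ Finset.uIcc x' x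
  · exact hJ.2 b hb x' hx' x hx c hc z hz h1
  by_cases h2 : z ∈ Finset.uIcc x y
  · exact h c hc z hz h2
  · refine hJ.2 b' hb' y hy y' hy' c hc z hz ?_
    rw [Finset.mem_uIcc] at *
    omega

/-- When the ground set has no gaps, an interval of integers lies in the ground set of `J` exactly
when all blocks of `P` meeting it are in `J`. -/
theorem ncSplit_eq_ncMonomial (K : Type*) [Field K] {P J : Finset (Finset ℕ)} {n : ℕ}
    (hP : IsNCPartition P (Finset.Icc 1 n)) (hJ : IsConvexIn P J) :
    ncSplit K J = ncMonomial K (components P J) := by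
  classical
  have hB := hP.isBlockFamily
  have hfil : ∀ b ∈ J, ∀ x ∈ b,
      (J.filter fun b' => b' ⊆ (ncGround J).filter fun y => Finset.uIcc x y ⊆ ncGround J)
        = J.filter (Linked P J b) := by
    intro b hb x hx
    refine Finset.filter_congr fun b' hb' => ⟨fun h => ?_, fun h y hy => ?_⟩
    · obtain ⟨y, hy⟩ := hB.nonempty b' (hJ.1 hb')
      refine hJ.linked_of_points hb hb' hx hy fun c hc z hz hzz => ?_
      obtain ⟨c', hc', hz'⟩ := mem_ncGround.1 ((Finset.mem_filter.1 (h hy)).2 hzz)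
      rwa [hB.eq_of_mem c hc c' (hJ.1 hc') z hz hz']
    · refine Finset.mem_filter.2 ⟨subset_ncGround hb' hy, fun z hz => ?_⟩
      have hxg : x ∈ ncGround P := subset_ncGround (hJ.1 hb) hx
      have hyg : y ∈ ncGround P := subset_ncGround (hJ.1 hb') hy
      -- The absence of gaps is used here: every integer between two points of `P` lies in a block
      -- of `P`.
      have hzg : z ∈ ncGround P := by
        rw [hP.union_eq, Finset.mem_Icc] at hxg hyg ⊢
        rw [Finset.mem_uIcc] at hz
        omega
      obtain ⟨c, hc, hzc⟩ := mem_ncGround.1 hzg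
      exact mem_ncGround.2 ⟨c, h x hx y hy c hc z hzc hz, hzc⟩
  have hcomp : components P J
      = (ncComponents (ncGround J)).image fun C => J.filter fun b => b ⊆ C := by
    ext c
    simp only [components, ncComponents, Finset.image_image, Finset.mem_image, Function.comp]
    constructor
    · rintro ⟨b, hb, rfl⟩
      obtain ⟨x, hx⟩ := hB.nonempty b (hJ.1 hb)
      exact ⟨x, subset_ncGround hb hx, hfil b hb x hx⟩
    · rintro ⟨x, hx, rfl⟩
      obtain ⟨b, hb, hxb⟩ := mem_ncGround.1 hx
      exact ⟨b, hb, (hfil b hb x hxb).symm⟩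
  have hground : ∀ C ∈ ncComponents (ncGround J), ncGround (J.filter fun b => b ⊆ C) = C := by
    intro C hC
    obtain ⟨x, hx, rfl⟩ := Finset.mem_image.1 hC
    obtain ⟨b, hb, hxb⟩ := mem_ncGround.1 hx
    ext y
    constructor
    · intro hy
      obtain ⟨b', hb', hy'⟩ := mem_ncGround.1 hy
      exact (Finset.mem_filter.1 hb').2 hy'
    · intro hy
      obtain ⟨hyJ, hxy⟩ := Finset.mem_filter.1 hy
      obtain ⟨b', hb', hyb⟩ := mem_ncGround.1 hyJ
      refine mem_ncGround.2 ⟨b', ?_, hyb⟩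
      rw [hfil b hb x hxb, Finset.mem_filter]
      refine ⟨hb', hJ.linked_of_points hb hb' hxb hyb fun c hc z hz hzz => ?_⟩
      obtain ⟨c', hc', hz'⟩ := mem_ncGround.1 (hxy hzz)
      rwa [hB.eq_of_mem c hc c' (hJ.1 hc') z hz hz']
  rw [ncSplit, ncMonomial, hcomp, Finset.prod_image]
  intro C hC D hD h
  rw [← hground C hC, ← hground D hD]
  exact congrArg ncGround h

section Delta

variable (K : Type*) [Field K]

/-- The separation formula for `Δ`, on a family of blocks. -/
def separationSum (P : Finset (Finset ℕ)) : NCPAlgebra K ⊗[K] NCPAlgebra K :=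
  ∑ J ∈ convexSubsets P, ncGen K (P \ J) ⊗ₜ[K] ncMonomial K (components P J)

theorem ncDeltaGen_eq (π : NCP) : ncDeltaGen K π = separationSum K π.blocks := by
  classical
  obtain ⟨n, -, h⟩ := π.isNCPartition
  rw [ncDeltaGen, separationSum]
  refine Finset.sum_congr ?_ fun J hJ => ?_
  · ext J
    rw [Finset.mem_filter, mem_convexSubsets, isNCIdeal_iff_isConvexIn π.isNCPartition_blocks,
      Finset.mem_powerset]
    exact ⟨fun h => h.2, fun h => ⟨h.1, h⟩⟩
  · rw [ncSplit_eq_ncMonomial K h (mem_convexSubsets.1 hJ)]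

theorem separationSum_image {P : Finset (Finset ℕ)} {φ : ℕ → ℕ} (hP : IsBlockFamily P)
    (hφ : StrictMonoOn φ (ncGround P)) :
    separationSum K (P.image (Finset.image φ)) = separationSum K P := by
  rw [separationSum, sum_convexSubsets_image hφ, separationSum]
  refine Finset.sum_congr rfl fun J hJ => ?_
  rw [mem_convexSubsets] at hJ
  rw [components_image hφ hJ.1, ncMonomial_image K hφ
    (fun c hc => ((isSetPartition_components hP hJ).subset hc).trans hJ.1)]
  congr 1
  have hinj := injOn_image_blocks hφ.injOn
  rw [← ncGen_image K (hφ.mono (Finset.coe_subset.2 (ncGround_mono Finset.sdiff_subset)))]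
  congr 1
  ext b
  simp only [Finset.mem_sdiff, Finset.mem_image]
  constructor
  · rintro ⟨⟨a, ha, rfl⟩, h⟩
    exact ⟨a, ⟨ha, fun h' => h ⟨a, h', rfl⟩⟩, rfl⟩
  · rintro ⟨a, ⟨ha, h⟩, rfl⟩
    refine ⟨⟨a, ha, rfl⟩, fun ⟨a', ha', e⟩ => h ?_⟩
    rwa [← hinj (hJ.1 ha') ha e]

theorem convexSubsets_empty : convexSubsets ∅ = {∅} := by
  ext J
  rw [mem_convexSubsets, Finset.mem_singleton]
  refine ⟨fun h => Finset.subset_empty.1 h.1, ?_⟩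
  rintro rfl
  exact ⟨subset_rfl, by simp⟩

theorem components_empty (P : Finset (Finset ℕ)) : components P ∅ = ∅ := by simp [components]

/-- Two crossing blocks are never separated by a convex `J`: each has a point between two points of
the other. They lie both in `P \ J`, or both in one component of `J`, and that factor is zero. -/
theorem separationSum_eq_zero {P : Finset (Finset ℕ)} (hP : IsBlockFamily P)
    (h : ¬IsNCPartition P (ncGround P)) : separationSum K P = 0 := by
  refine Finset.sum_eq_zero fun J hJ => ?_
  rw [mem_convexSubsets] at hJ
  have hpart := isSetPartition_components hP hJ
  by_cases h1 : IsNCPartition (P \ J) (ncGround (P \ J))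
  swap
  · rw [ncGen_eq_zero K h1, TensorProduct.zero_tmul]
  by_cases h2 : ∀ c ∈ components P J, IsNCPartition c (ncGround c)
  swap
  · push Not at h2
    obtain ⟨c, hc, hn⟩ := h2
    rw [ncMonomial, Finset.prod_eq_zero hc (ncGen_eq_zero K hn), TensorProduct.tmul_zero]
  refine absurd (hP.isNCPartition_iff.2 ?_) h
  rintro b hb c hc hbc x hx z hz y hy t ht ⟨hxy, hyz, hzt⟩
  by_cases hbJ : b ∈ J
  · have hcJ : c ∈ J := hJ.2 b hbJ x hx z hz c hc y hy (by rw [Finset.mem_uIcc]; omega)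
    obtain ⟨d, hd, hbd⟩ := hpart.exists_mem hbJ
    refine (h2 d hd).noncrossing b hbd c ?_ hbc x hx z hz y hy t ht ⟨hxy, hyz, hzt⟩
    refine mem_of_linked hP hJ.1 hd hbd hcJ (hJ.linked_of_points hbJ hcJ hz hy ?_)
    intro e he w hw hww
    refine hJ.2 b hbJ x hx z hz e he w hw ?_
    rw [Finset.mem_uIcc] at hww ⊢
    omega
  · have hcJ : c ∉ J := fun hcJ =>
      hbJ (hJ.2 c hcJ y hy t ht b hb z hz (by rw [Finset.mem_uIcc]; omega))
    exact h1.noncrossing b (Finset.mem_sdiff.2 ⟨hb, hbJ⟩) c (Finset.mem_sdiff.2 ⟨hc, hcJ⟩) hbc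
      x hx z hz y hy t ht ⟨hxy, hyz, hzt⟩

theorem ncDelta_ncGen {P : Finset (Finset ℕ)} (hP : IsBlockFamily P) :
    ncDelta K (ncGen K P) = separationSum K P := by
  by_cases h : IsNCPartition P (ncGround P)
  swap
  · rw [ncGen_eq_zero K h, map_zero, separationSum_eq_zero K hP h]
  rcases P.eq_empty_or_nonempty with rfl | hne
  · rw [ncGen_empty, map_one, separationSum, convexSubsets_empty, Finset.sum_singleton,
      components_empty, ncMonomial, Finset.prod_empty, Finset.sdiff_self, ncGen_empty]
    rfl
  · rw [ncGen_eq_X K h hne, ncDelta, MvPolynomial.aeval_X, ncDeltaGen_eq]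
    exact separationSum_image K hP (strictMonoOn_ncRank _)

end Delta

/-! ### The coproduct by fusion on families of blocks -/

/-- Fuse the blocks of each element of `X`. -/
def fuse (X : Finset (Finset (Finset ℕ))) : Finset (Finset ℕ) := X.image ncGround

section Fuse

variable {P : Finset (Finset ℕ)} {X : Finset (Finset (Finset ℕ))}

/-- Disjoint nonempty blocks are determined by their union, so fusing never identifies distinct
classes. -/
theorem IsBlockFamily.ncGround_injOn (hP : IsBlockFamily P) :
    Set.InjOn ncGround {c | c ⊆ P} := by
  have aux : ∀ c ⊆ P, ∀ d ⊆ P, ncGround c = ncGround d → c ⊆ d := by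
    intro c hc d hd h b hb
    obtain ⟨x, hx⟩ := hP.nonempty b (hc hb)
    obtain ⟨b', hb', hx'⟩ := mem_ncGround.1 (h ▸ subset_ncGround hb hx : x ∈ ncGround d)
    rwa [hP.eq_of_mem b (hc hb) b' (hd hb') x hx hx']
  exact fun c hc d hd h => (aux c hc d hd h).antisymm (aux d hd c hc h.symm)

theorem ncGround_fuse (hX : IsSetPartition X P) : ncGround (fuse X) = ncGround P := by
  ext x
  simp only [mem_ncGround, fuse, Finset.exists_mem_image]
  constructor
  · rintro ⟨c, hc, b, hb, hx⟩
    exact ⟨b, hX.subset hc hb, hx⟩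
  · rintro ⟨b, hb, hx⟩
    obtain ⟨c, hc, hbc⟩ := hX.exists_mem hb
    exact ⟨c, hc, b, hbc, hx⟩

theorem isBlockFamily_fuse (hP : IsBlockFamily P) (hX : IsSetPartition X P) :
    IsBlockFamily (fuse X) := by
  refine isBlockFamily_iff.2 ⟨?_, ?_⟩
  · simp only [fuse, Finset.forall_mem_image]
    intro c hc
    obtain ⟨b, hb⟩ := hX.nonempty c hc
    exact (hP.nonempty b (hX.subset hc hb)).mono (subset_ncGround hb)
  · simp only [fuse, Finset.forall_mem_image]
    intro c hc d hd x hx hx'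
    obtain ⟨b, hb, hxb⟩ := mem_ncGround.1 hx
    obtain ⟨b', hb', hxb'⟩ := mem_ncGround.1 hx'
    obtain rfl := hP.eq_of_mem b (hX.subset hc hb) b' (hX.subset hd hb') x hxb hxb'
    rw [hX.eq_of_mem c hc d hd b hb hb']

theorem fuse_image {φ : ℕ → ℕ} :
    fuse (X.image (Finset.image (Finset.image φ))) = (fuse X).image (Finset.image φ) := by
  rw [fuse, fuse, Finset.image_image, Finset.image_image]
  exact Finset.image_congr fun c _ => ncGround_image

end Fuse

section FusionDelta

variable (K : Type*) [Field K]

/-- The fusion formula for `δ`, on a family of blocks. -/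
def fusionSum (P : Finset (Finset ℕ)) : NCPAlgebra K ⊗[K] NCPAlgebra K :=
  ∑ X ∈ setPartitions P, ncGen K (fuse X) ⊗ₜ[K] ncMonomial K X

/-- The condition that the fusion be noncrossing can be dropped, since the other terms vanish. -/
theorem ncFusionDeltaGen_eq (π : NCP) : ncFusionDeltaGen K π = fusionSum K π.blocks := by
  classical
  rw [ncFusionDeltaGen, Finset.sum_filter_of_ne, fusionSum, ← sum_finpartition]
  · rfl
  · intro r _ h
    by_contra hn
    refine h ?_
    have hr : ncGround (ncFusion r) = ncGround π.blocks := by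
      ext x
      simp only [mem_ncGround, ncFusion, Finset.exists_mem_image]
      constructor
      · rintro ⟨c, hc, b, hb, hx⟩
        exact ⟨b, r.le hc hb, hx⟩
      · rintro ⟨b, hb, hx⟩
        obtain ⟨c, hc, hbc⟩ := r.exists_mem hb
        exact ⟨c, hc, b, hbc, hx⟩
    rw [← hr] at hn
    rw [ncGen_eq_zero K hn, TensorProduct.zero_tmul]

theorem fusionSum_image {P : Finset (Finset ℕ)} {φ : ℕ → ℕ}
    (hφ : StrictMonoOn φ (ncGround P)) :
    fusionSum K (P.image (Finset.image φ)) = fusionSum K P := by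
  rw [fusionSum, sum_setPartitions_image (injOn_image_blocks hφ.injOn), fusionSum]
  refine Finset.sum_congr rfl fun X hX => ?_
  rw [mem_setPartitions] at hX
  rw [ncMonomial_image K hφ fun c hc => hX.subset hc, fuse_image,
    ncGen_image K (by rwa [ncGround_fuse hX])]

/-- Two crossing blocks either share a class, which is then crossing, or have distinct classes,
whose unions then cross in the fusion. -/
theorem fusionSum_eq_zero {P : Finset (Finset ℕ)} (hP : IsBlockFamily P)
    (h : ¬IsNCPartition P (ncGround P)) : fusionSum K P = 0 := by
  refine Finset.sum_eq_zero fun X hX => ?_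
  rw [mem_setPartitions] at hX
  by_cases h1 : IsNCPartition (fuse X) (ncGround (fuse X))
  swap
  · rw [ncGen_eq_zero K h1, TensorProduct.zero_tmul]
  by_cases h2 : ∀ c ∈ X, IsNCPartition c (ncGround c)
  swap
  · push Not at h2
    obtain ⟨c, hc, hn⟩ := h2
    rw [ncMonomial, Finset.prod_eq_zero hc (ncGen_eq_zero K hn), TensorProduct.tmul_zero]
  refine absurd (hP.isNCPartition_iff.2 ?_) h
  intro b hb c hc hbc x hx z hz y hy t ht hcr
  obtain ⟨d, hd, hbd⟩ := hX.exists_mem hb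
  obtain ⟨d', hd', hcd⟩ := hX.exists_mem hc
  by_cases hdd : d = d'
  · subst hdd
    exact (h2 d hd).noncrossing b hbd c hcd hbc x hx z hz y hy t ht hcr
  · refine h1.noncrossing _ (Finset.mem_image_of_mem _ hd) _ (Finset.mem_image_of_mem _ hd')
      (fun e => hdd (hP.ncGround_injOn (hX.subset hd) (hX.subset hd') e)) x
      (subset_ncGround hbd hx) z (subset_ncGround hbd hz) y (subset_ncGround hcd hy) t
      (subset_ncGround hcd ht) hcr

theorem setPartitions_empty {α : Type*} : setPartitions (∅ : Finset α) = {∅} := by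
  ext X
  rw [mem_setPartitions, Finset.mem_singleton]
  constructor
  · intro h
    rw [Finset.eq_empty_iff_forall_notMem]
    intro c hc
    obtain ⟨a, ha⟩ := h.nonempty c hc
    exact absurd (h.subset hc ha) (by simp)
  · rintro rfl
    exact ⟨by simp, by simp, by simp⟩

theorem ncFusionDelta_ncGen {P : Finset (Finset ℕ)} (hP : IsBlockFamily P) :
    ncFusionDelta K (ncGen K P) = fusionSum K P := by
  by_cases h : IsNCPartition P (ncGround P)
  swap
  · rw [ncGen_eq_zero K h, map_zero, fusionSum_eq_zero K hP h]
  rcases P.eq_empty_or_nonempty with rfl | hne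
  · rw [ncGen_empty, map_one, fusionSum, setPartitions_empty, Finset.sum_singleton,
      ncMonomial, Finset.prod_empty, fuse, Finset.image_empty, ncGen_empty]
    rfl
  · rw [ncGen_eq_X K h hne, ncFusionDelta, MvPolynomial.aeval_X, ncFusionDeltaGen_eq]
    exact fusionSum_image K (strictMonoOn_ncRank _)

end FusionDelta

theorem prod_tmul_prod {K A B ι : Type*} [CommRing K] [CommRing A] [CommRing B] [Algebra K A]
    [Algebra K B] (s : Finset ι) (f : ι → A) (g : ι → B) :
    ∏ i ∈ s, (f i ⊗ₜ[K] g i) = (∏ i ∈ s, f i) ⊗ₜ[K] ∏ i ∈ s, g i := by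
  classical
  induction s using Finset.induction_on with
  | empty => rfl
  | insert a s ha ih =>
    rw [Finset.prod_insert ha, Finset.prod_insert ha, Finset.prod_insert ha, ih,
      Algebra.TensorProduct.tmul_mul_tmul]

/-! ### Nested convex sets -/

section Nested

variable {P L J : Finset (Finset ℕ)}

theorem uIcc_subset_left {x y z w : ℕ} (h : z ∈ Finset.uIcc x y) (h' : w ∈ Finset.uIcc x z) :
    w ∈ Finset.uIcc x y := by
  rw [Finset.mem_uIcc'] at *
  omega

theorem mem_component_of_between {e b b' : Finset ℕ} {C : Finset (Finset ℕ)}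
    (hP : IsBlockFamily P) (hL : IsConvexIn P L)
    (hC : C ∈ components P L) (hb : b ∈ C) (hb' : b' ∈ C) {x y z : ℕ} (hx : x ∈ b) (hy : y ∈ b')
    (he : e ∈ P) (hz : z ∈ e) (h : z ∈ Finset.uIcc x y) : e ∈ C := by
  have hl := linked_of_mem_components hP hL.1 hC hb hb'
  have heL := hl x hx y hy e he z hz h
  exact mem_of_linked hP hL.1 hC hb heL (hL.linked_of_points
    ((isSetPartition_components hP hL).subset hC hb) heL hx hz
    fun f hf w hw hww => hl x hx y hy f hf w hw (uIcc_subset_left h hww))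

theorem IsConvexIn.trans (hL : IsConvexIn P L) (hJ : IsConvexIn L J) : IsConvexIn P J :=
  ⟨hJ.1.trans hL.1, fun b hb x hx y hy e he z hz h =>
    hJ.2 b hb x hx y hy e (hL.2 b (hJ.1 hb) x hx y hy e he z hz h) z hz h⟩

theorem IsConvexIn.sdiff (hL : IsConvexIn P L) : IsConvexIn (P \ J) (L \ J) := by
  refine ⟨Finset.sdiff_subset_sdiff hL.1 subset_rfl, fun b hb x hx y hy e he z hz h => ?_⟩
  rw [Finset.mem_sdiff] at *
  exact ⟨hL.2 b hb.1 x hx y hy e he.1 z hz h, he.2⟩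

theorem IsConvexIn.union {I : Finset (Finset ℕ)} (hJ : IsConvexIn P J)
    (hI : IsConvexIn (P \ J) I) : IsConvexIn P (J ∪ I) := by
  refine ⟨Finset.union_subset hJ.1 (hI.1.trans Finset.sdiff_subset),
    fun b hb x hx y hy e he z hz h => ?_⟩
  rw [Finset.mem_union] at *
  by_cases heJ : e ∈ J
  · exact Or.inl heJ
  rcases hb with hb | hb
  · exact Or.inl (hJ.2 b hb x hx y hy e he z hz h)
  · exact Or.inr (hI.2 b hb x hx y hy e (Finset.mem_sdiff.2 ⟨he, heJ⟩) z hz h)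

theorem IsConvexIn.of_subset (hJ : IsConvexIn P J) (hJL : J ⊆ L) (hL : L ⊆ P) :
    IsConvexIn L J :=
  ⟨hJL, fun b hb x hx y hy e he z hz h => hJ.2 b hb x hx y hy e (hL he) z hz h⟩

theorem linked_sdiff_iff {b b' : Finset ℕ} (hJ : J ⊆ L) :
    Linked (P \ J) (L \ J) b b' ↔ Linked P L b b' := by
  constructor
  · intro h x hx y hy e he z hz hzz
    by_cases heJ : e ∈ J
    · exact hJ heJ
    · exact (Finset.mem_sdiff.1 (h x hx y hy e (Finset.mem_sdiff.2 ⟨he, heJ⟩) z hz hzz)).1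
  · intro h x hx y hy e he z hz hzz
    rw [Finset.mem_sdiff] at he ⊢
    exact ⟨h x hx y hy e he.1 z hz hzz, he.2⟩

/-- Locality: every block of `P` with a point between two blocks of a component belongs to that
component, so links can be tested inside it. -/
theorem linked_component_iff {b b' : Finset ℕ} {C : Finset (Finset ℕ)}
    (hP : IsBlockFamily P) (hL : IsConvexIn P L) (hC : C ∈ components P L) (hb : b ∈ C)
    (hb' : b' ∈ C) : Linked C (J.filter (· ∈ C)) b b' ↔ Linked P J b b' := by
  have hCP := ((isSetPartition_components hP hL).subset hC).trans hL.1
  constructor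
  · intro h x hx y hy e he z hz hzz
    exact (Finset.mem_filter.1 (h x hx y hy e
      (mem_component_of_between hP hL hC hb hb' hx hy he hz hzz) z hz hzz)).1
  · intro h x hx y hy e he z hz hzz
    exact Finset.mem_filter.2 ⟨h x hx y hy e (hCP he) z hz hzz, he⟩

theorem isConvexIn_iff_forall_components (hP : IsBlockFamily P) (hL : IsConvexIn P L) :
    IsConvexIn L J ↔ (∀ b ∈ J, ∃ C ∈ components P L, b ∈ C) ∧
      ∀ C ∈ components P L, IsConvexIn C (J.filter (· ∈ C)) := by
  have hpart := isSetPartition_components hP hL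
  constructor
  · intro h
    refine ⟨fun b hb => hpart.exists_mem (h.1 hb), fun C hC => ⟨fun b hb => ?_, ?_⟩⟩
    · exact (Finset.mem_filter.1 hb).2
    · intro b hb
      rw [Finset.mem_filter] at hb
      rw [linked_component_iff hP hL hC hb.2 hb.2]
      exact (hL.trans h).2 b hb.1
  · rintro ⟨h1, h2⟩
    refine ⟨fun b hb => ?_, fun b hb x hx y hy e he z hz h => ?_⟩
    · obtain ⟨C, hC, hbC⟩ := h1 b hb
      exact hpart.subset hC hbC
    · obtain ⟨C, hC, hbC⟩ := h1 b hb
      have := (h2 C hC).2 b (Finset.mem_filter.2 ⟨hb, hbC⟩)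
      rw [linked_component_iff hP hL hC hbC hbC] at this
      exact this x hx y hy e (hL.1 he) z hz h

variable (K : Type*) [Field K]

/-- Deleting `J ⊆ L` does not change which remaining blocks are linked, so components are merely
truncated. Those contained in `J` disappear on the left and contribute `ncGen K ∅ = 1` on the right.
-/
theorem ncMonomial_components_sdiff (hP : IsBlockFamily P) (hL : IsConvexIn P L) (hJ : J ⊆ L) :
    ncMonomial K (components (P \ J) (L \ J)) = ∏ C ∈ components P L, ncGen K (C \ J) := by
  classical
  have hpart := isSetPartition_components hP hL
  have hcomp : components (P \ J) (L \ J)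
      = ((components P L).filter fun C => (C \ J).Nonempty).image (· \ J) := by
    have haux : ∀ b, (L \ J).filter (Linked (P \ J) (L \ J) b) = L.filter (Linked P L b) \ J := by
      intro b
      ext b'
      simp only [Finset.mem_filter, Finset.mem_sdiff, linked_sdiff_iff hJ]
      tauto
    ext c
    simp only [components, Finset.mem_image, Finset.mem_filter, haux]
    constructor
    · rintro ⟨b, hb, rfl⟩
      rw [Finset.mem_sdiff] at hb
      refine ⟨_, ⟨⟨b, hb.1, rfl⟩, b, ?_⟩, rfl⟩
      exact Finset.mem_sdiff.2 ⟨Finset.mem_filter.2 ⟨hb.1, hL.2 b hb.1⟩, hb.2⟩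
    · rintro ⟨C, ⟨⟨a, ha, rfl⟩, b, hb⟩, rfl⟩
      obtain ⟨hb, hbJ⟩ := Finset.mem_sdiff.1 hb
      have hC : L.filter (Linked P L a) ∈ components P L := Finset.mem_image_of_mem _ ha
      have hbL := (Finset.mem_filter.1 hb).1
      refine ⟨b, Finset.mem_sdiff.2 ⟨hbL, hbJ⟩, ?_⟩
      congr 1
      exact hpart.eq_of_mem _ (Finset.mem_image_of_mem _ hbL) _ hC b
        (Finset.mem_filter.2 ⟨hbL, hL.2 b hbL⟩) hb
  rw [ncMonomial, hcomp, Finset.prod_image, Finset.prod_filter_of_ne]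
  · intro C hC h
    rw [Finset.nonempty_iff_ne_empty]
    intro he
    rw [he, ncGen_empty] at h
    exact h rfl
  · intro C hC D hD h
    obtain ⟨hC, b, hb⟩ := Finset.mem_filter.1 hC
    obtain ⟨hD, -⟩ := Finset.mem_filter.1 hD
    have hb' : b ∈ D \ J := by simp only at h; rwa [← h]
    exact hpart.eq_of_mem C hC D hD b (Finset.mem_sdiff.1 hb).1 (Finset.mem_sdiff.1 hb').1

theorem prod_ncMonomial_components (hP : IsBlockFamily P) (hL : IsConvexIn P L)
    (hJ : IsConvexIn L J) :
    ∏ C ∈ components P L, ncMonomial K (components C (J.filter (· ∈ C)))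
      = ncMonomial K (components P J) := by
  classical
  have hpart := isSetPartition_components hP hL
  have haux : ∀ C ∈ components P L, ∀ b ∈ J, b ∈ C →
      (J.filter (· ∈ C)).filter (Linked C (J.filter (· ∈ C)) b) = J.filter (Linked P J b) := by
    intro C hC b hb hbC
    ext b'
    simp only [Finset.mem_filter]
    constructor
    · rintro ⟨⟨hb', hbC'⟩, h⟩
      exact ⟨hb', (linked_component_iff hP hL hC hbC hbC').1 h⟩
    · rintro ⟨hb', h⟩
      have hbC' : b' ∈ C := mem_of_linked hP hL.1 hC hbC (hJ.1 hb')
        fun x hx y hy e he z hz hzz => hJ.1 (h x hx y hy e he z hz hzz)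
      exact ⟨⟨hb', hbC'⟩, (linked_component_iff hP hL hC hbC hbC').2 h⟩
  have hcomp : components P J
      = (components P L).biUnion fun C => components C (J.filter (· ∈ C)) := by
    ext c
    rw [Finset.mem_biUnion]
    constructor
    · intro hc
      obtain ⟨b, hb, rfl⟩ := Finset.mem_image.1 hc
      obtain ⟨C, hC, hbC⟩ := hpart.exists_mem (hJ.1 hb)
      exact ⟨C, hC, Finset.mem_image.2 ⟨b, Finset.mem_filter.2 ⟨hb, hbC⟩, haux C hC b hb hbC⟩⟩
    · rintro ⟨C, hC, hc⟩
      obtain ⟨b, hb, rfl⟩ := Finset.mem_image.1 hc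
      obtain ⟨hb, hbC⟩ := Finset.mem_filter.1 hb
      exact Finset.mem_image.2 ⟨b, hb, (haux C hC b hb hbC).symm⟩
  rw [ncMonomial, hcomp, Finset.prod_biUnion]
  · rfl
  · intro C hC D hD hCD
    rw [Function.onFun, Finset.disjoint_left]
    intro c hc hd
    obtain ⟨b, hb, rfl⟩ := Finset.mem_image.1 hc
    obtain ⟨hb, hbC⟩ := Finset.mem_filter.1 hb
    rw [haux C hC b hb hbC] at hd
    have hm : b ∈ J.filter (Linked P J b) := Finset.mem_filter.2 ⟨hb, (hL.trans hJ).2 b hb⟩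
    obtain ⟨b', hb', e⟩ := Finset.mem_image.1 hd
    rw [← e] at hm
    exact hCD (hpart.eq_of_mem C hC D hD b hbC
      (Finset.mem_filter.1 (Finset.mem_filter.1 hm).1).2)

theorem ncDelta_ncMonomial_components (hP : IsBlockFamily P) (hL : IsConvexIn P L) :
    ncDelta K (ncMonomial K (components P L)) = ∑ J ∈ convexSubsets L,
      ncMonomial K (components (P \ J) (L \ J)) ⊗ₜ[K] ncMonomial K (components P J) := by
  have hpart := isSetPartition_components hP hL
  rw [ncMonomial, map_prod, Finset.prod_congr rfl fun C hC =>
    ncDelta_ncGen K (hP.mono ((hpart.subset hC).trans hL.1))]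
  simp only [separationSum]
  rw [prod_sum_glue (components P L) convexSubsets (fun C b => b ∈ C) (convexSubsets L)]
  · refine Finset.sum_congr rfl fun J hJ => ?_
    rw [mem_convexSubsets] at hJ
    rw [prod_tmul_prod, prod_ncMonomial_components K hP hL hJ,
      ncMonomial_components_sdiff K hP hL hJ.1]
    congr 1
    refine Finset.prod_congr rfl fun C _ => congrArg _ ?_
    ext b
    simp only [Finset.mem_sdiff, Finset.mem_filter]
    tauto
  · exact fun C hC T hT b hb => (mem_convexSubsets.1 hT).1 hb
  · exact fun C hC T hT b hb D hD hbD =>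
      hpart.eq_of_mem D hD C hC b hbD ((mem_convexSubsets.1 hT).1 hb)
  · intro J
    simp only [mem_convexSubsets]
    exact isConvexIn_iff_forall_components hP hL

theorem ncDelta_coassoc :
    (Algebra.TensorProduct.assoc K K K (NCPAlgebra K) (NCPAlgebra K) (NCPAlgebra K)).toAlgHom.comp
      ((Algebra.TensorProduct.map (ncDelta K) (AlgHom.id K _)).comp (ncDelta K))
    = (Algebra.TensorProduct.map (AlgHom.id K _) (ncDelta K)).comp (ncDelta K) := by
  refine algHom_ext_ncGen K fun P hP _ => ?_
  replace hP := hP.isBlockFamily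
  simp only [AlgHom.comp_apply, ncDelta_ncGen K hP]
  rw [separationSum]
  simp only [map_sum, Algebra.TensorProduct.map_tmul, AlgHom.id_apply]
  refine (Finset.sum_congr (g := fun J => ∑ I ∈ convexSubsets (P \ J),
      ncGen K ((P \ J) \ I) ⊗ₜ[K] (ncMonomial K (components (P \ J) I) ⊗ₜ[K]
        ncMonomial K (components P J))) rfl fun J _ => ?_).trans
    (Eq.trans ?_ (Finset.sum_congr (f := fun L => ∑ J ∈ convexSubsets L,
      ncGen K (P \ L) ⊗ₜ[K] (ncMonomial K (components (P \ J) (L \ J)) ⊗ₜ[K]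
        ncMonomial K (components P J))) rfl fun L hL => ?_))
  · rw [ncDelta_ncGen K (hP.mono Finset.sdiff_subset), separationSum, TensorProduct.sum_tmul,
      map_sum]
    rfl
  swap
  · rw [ncDelta_ncMonomial_components K hP (mem_convexSubsets.1 hL), TensorProduct.tmul_sum]
  rw [Finset.sum_sigma', Finset.sum_sigma']
  -- `(J, I) ↦ (J ∪ I, J)`, with inverse `(L, J) ↦ (J, L \ J)`.
  refine Finset.sum_bij' (fun p _ => ⟨p.1 ∪ p.2, p.1⟩) (fun p _ => ⟨p.2, p.1 \ p.2⟩) ?_ ?_ ?_ ?_ ?_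
  · rintro ⟨J, I⟩ h
    simp only [Finset.mem_sigma, mem_convexSubsets] at h ⊢
    have := h.1.union h.2
    exact ⟨this, h.1.of_subset Finset.subset_union_left this.1⟩
  · rintro ⟨L, J⟩ h
    simp only [Finset.mem_sigma, mem_convexSubsets] at h ⊢
    exact ⟨h.1.trans h.2, h.1.sdiff⟩
  · rintro ⟨J, I⟩ h
    simp only [Finset.mem_sigma, mem_convexSubsets] at h
    have hd : Disjoint J I := (Finset.subset_sdiff.1 h.2.1).2.symm
    simp [Finset.union_sdiff_cancel_left hd]
  · rintro ⟨L, J⟩ h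
    simp only [Finset.mem_sigma, mem_convexSubsets] at h
    simp [Finset.union_sdiff_of_subset h.2.1]
  · rintro ⟨J, I⟩ h
    simp only [Finset.mem_sigma, mem_convexSubsets] at h
    have hd : Disjoint J I := (Finset.subset_sdiff.1 h.2.1).2.symm
    simp only [Finset.union_sdiff_cancel_left hd, sdiff_sdiff_left, Finset.sup_eq_union]

end Nested

/-! ### Iterated fusions -/

section Fusion

variable {P J : Finset (Finset ℕ)} {X Q : Finset (Finset (Finset ℕ))}

theorem IsSetPartition.mono_sup {U : Finset (Finset (Finset ℕ))}
    (hX : IsSetPartition X P) (hU : U ⊆ X) : IsSetPartition U (U.sup id) :=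
  ⟨fun c hc => hX.nonempty c (hU hc), fun a => by simp [Finset.mem_sup],
    fun c hc d hd => hX.eq_of_mem c (hU hc) d (hU hd)⟩

theorem ncGround_fuse_restrict (hX : IsSetPartition X P) (hQ : IsSetPartition Q P)
    (h : Refines X Q) {q : Finset (Finset ℕ)} (hq : q ∈ Q) :
    ncGround (fuse (X.filter (· ⊆ q))) = ncGround q :=
  ncGround_fuse (hX.restrict hQ h hq)

theorem fuse_restrict_injOn (hP : IsBlockFamily P) (hX : IsSetPartition X P)
    (hQ : IsSetPartition Q P) (h : Refines X Q) :
    Set.InjOn (fun q => fuse (X.filter (· ⊆ q))) (Q : Set (Finset (Finset ℕ))) := by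
  intro q hq q' hq' e
  have := congrArg ncGround e
  simp only [ncGround_fuse_restrict hX hQ h hq, ncGround_fuse_restrict hX hQ h hq'] at this
  exact hP.ncGround_injOn (hQ.subset hq) (hQ.subset hq') this

variable (K : Type*) [Field K]

-- A partition of the fused blocks is a coarsening `Q` of `X`, and fusing in two stages yields the
-- same blocks as fusing along `Q`.
open Classical in
theorem fusionSum_fuse (hP : IsBlockFamily P) (hX : IsSetPartition X P) :
    fusionSum K (fuse X) = ∑ Q ∈ (setPartitions P).filter (Refines X),
      ncGen K (fuse Q) ⊗ₜ[K] ∏ q ∈ Q, ncGen K (fuse (X.filter (· ⊆ q))) := by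
  have hinj : Set.InjOn ncGround (X : Set (Finset (Finset ℕ))) :=
    hP.ncGround_injOn.mono fun c hc => hX.subset hc
  rw [fusionSum, fuse, sum_setPartitions_image hinj, sum_setPartitions_coarsen hX _
    ((setPartitions P).filter (Refines X)) fun Q => by
      rw [Finset.mem_filter, mem_setPartitions]]
  refine Finset.sum_congr rfl fun Q hQ => ?_
  rw [Finset.mem_filter, mem_setPartitions] at hQ
  obtain ⟨hQ, h⟩ := hQ
  rw [Finset.image_image]
  congr 1
  · congr 1
    rw [fuse, fuse, Finset.image_image]
    exact Finset.image_congr fun q hq => ncGround_fuse_restrict hX hQ h hq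
  · exact Finset.prod_image (fuse_restrict_injOn hP hX hQ h)

theorem ncFusionDelta_ncMonomial (hP : IsBlockFamily P) (hQ : IsSetPartition Q P) :
    ncFusionDelta K (ncMonomial K Q) = ∑ X ∈ refinements P Q,
      (∏ q ∈ Q, ncGen K (fuse (X.filter (· ⊆ q)))) ⊗ₜ[K] ncMonomial K X := by
  rw [ncMonomial, map_prod, Finset.prod_congr rfl fun q hq =>
    ncFusionDelta_ncGen K (hP.mono (hQ.subset hq))]
  simp only [fusionSum]
  rw [prod_sum_setPartitions hQ]
  refine Finset.sum_congr rfl fun X hX => ?_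
  rw [mem_refinements] at hX
  obtain ⟨hX, h⟩ := hX
  rw [prod_tmul_prod]
  congr 1
  have : X = Q.biUnion fun q => X.filter (· ⊆ q) := by
    ext d
    simp only [Finset.mem_biUnion, Finset.mem_filter]
    exact ⟨fun hd => (h d hd).imp fun q hq => ⟨hq.1, hd, hq.2⟩, fun ⟨_, _, hd, _⟩ => hd⟩
  conv_rhs => rw [this]
  rw [ncMonomial, Finset.prod_biUnion]
  · rfl
  · intro q hq q' hq' hne
    rw [Function.onFun, Finset.disjoint_left]
    intro d hd hd'
    rw [Finset.mem_filter] at hd hd'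
    exact hne (hX.eq_of_subset hQ hd.1 hq hq' hd.2 hd'.2)

theorem ncFusionDelta_coassoc :
    (Algebra.TensorProduct.assoc K K K (NCPAlgebra K) (NCPAlgebra K) (NCPAlgebra K)).toAlgHom.comp
      ((Algebra.TensorProduct.map (ncFusionDelta K) (AlgHom.id K _)).comp (ncFusionDelta K))
    = (Algebra.TensorProduct.map (AlgHom.id K _) (ncFusionDelta K)).comp (ncFusionDelta K) := by
  classical
  refine algHom_ext_ncGen K fun P hP _ => ?_
  replace hP := hP.isBlockFamily
  simp only [AlgHom.comp_apply, ncFusionDelta_ncGen K hP]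
  rw [fusionSum]
  simp only [map_sum, Algebra.TensorProduct.map_tmul, AlgHom.id_apply]
  refine (Finset.sum_congr (g := fun X => ∑ Q ∈ (setPartitions P).filter (Refines X),
      ncGen K (fuse Q) ⊗ₜ[K] ((∏ q ∈ Q, ncGen K (fuse (X.filter (· ⊆ q)))) ⊗ₜ[K]
        ncMonomial K X)) rfl fun X hX => ?_).trans
    (Eq.trans ?_ (Finset.sum_congr (f := fun Q => ∑ X ∈ refinements P Q,
      ncGen K (fuse Q) ⊗ₜ[K] ((∏ q ∈ Q, ncGen K (fuse (X.filter (· ⊆ q)))) ⊗ₜ[K]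
        ncMonomial K X)) rfl fun Q hQ => ?_))
  · rw [mem_setPartitions] at hX
    rw [ncFusionDelta_ncGen K (isBlockFamily_fuse hP hX), fusionSum_fuse K hP hX,
      TensorProduct.sum_tmul, map_sum]
    rfl
  · refine Finset.sum_comm' fun X Q => ?_
    rw [Finset.mem_filter, mem_refinements, mem_setPartitions, mem_setPartitions]
    tauto
  · rw [ncFusionDelta_ncMonomial K hP (mem_setPartitions.1 hQ), TensorProduct.tmul_sum]

/-! ### Cointeraction -/

/-- The points of a fused block are those of its constituents, and a fused block is kept exactly
when all its constituents are. -/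
theorem linked_fuse_iff {U : Finset (Finset (Finset ℕ))} (hP : IsBlockFamily P)
    (hX : IsSetPartition X P) (hU : U ⊆ X) {e e' : Finset (Finset ℕ)} :
    Linked (fuse X) (fuse U) (ncGround e) (ncGround e') ↔
      ∀ b ∈ e, ∀ b' ∈ e', Linked P (U.sup id) b b' := by
  constructor
  · intro h b hb b' hb' x hx y hy c hc z hz hzz
    obtain ⟨f, hf, hcf⟩ := hX.exists_mem hc
    obtain ⟨f', hf', e'⟩ := Finset.mem_image.1 (h x (subset_ncGround hb hx) y
      (subset_ncGround hb' hy) (ncGround f) (Finset.mem_image_of_mem _ hf) z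
      (subset_ncGround hcf hz) hzz)
    obtain rfl := hP.ncGround_injOn (hX.subset (hU hf')) (hX.subset hf) e'
    exact Finset.mem_sup.2 ⟨f', hf', hcf⟩
  · intro h x hx y hy g hg z hz hzz
    obtain ⟨f, hf, rfl⟩ := Finset.mem_image.1 hg
    obtain ⟨b, hb, hxb⟩ := mem_ncGround.1 hx
    obtain ⟨b', hb', hyb⟩ := mem_ncGround.1 hy
    obtain ⟨c, hc, hzc⟩ := mem_ncGround.1 hz
    obtain ⟨f', hf', hcf⟩ := Finset.mem_sup.1
      (h b hb b' hb' x hxb y hyb c (hX.subset hf hc) z hzc hzz)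
    obtain rfl := hX.eq_of_mem f hf f' (hU hf') c hc hcf
    exact Finset.mem_image_of_mem _ hf'

theorem isConvexIn_fuse_iff {U : Finset (Finset (Finset ℕ))} (hP : IsBlockFamily P)
    (hX : IsSetPartition X P) (hU : U ⊆ X) : IsConvexIn (fuse X) (fuse U) ↔
      IsConvexIn P (U.sup id) ∧ Refines U (components P (U.sup id)) := by
  have hsub : U.sup id ⊆ P := Finset.sup_le fun c hc => hX.subset (hU hc)
  rw [refines_components_iff hP hsub (hX.mono_sup hU), IsConvexIn,
    and_iff_right (show fuse U ⊆ fuse X from Finset.image_subset_image hU)]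
  exact Finset.forall_mem_image.trans (forall₂_congr fun e _ => linked_fuse_iff hP hX hU)

theorem ncMonomial_components_fuse {U : Finset (Finset (Finset ℕ))} (hP : IsBlockFamily P)
    (hX : IsSetPartition X P) (hU : U ⊆ X) (hJ : IsConvexIn P (U.sup id))
    (h : Refines U (components P (U.sup id))) :
    ncMonomial K (components (fuse X) (fuse U))
      = ∏ C ∈ components P (U.sup id), ncGen K (fuse (U.filter (· ⊆ C))) := by
  classical
  have hpart := isSetPartition_components hP hJ
  have hUpart := hX.mono_sup hU
  have haux : ∀ C ∈ components P (U.sup id), ∀ e ∈ U, e ⊆ C →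
      (fuse U).filter (Linked (fuse X) (fuse U) (ncGround e)) = fuse (U.filter (· ⊆ C)) := by
    intro C hC e he heC
    refine Finset.filter_image.trans (congrArg fuse ?_)
    refine Finset.filter_congr fun e' he' => ?_
    rw [linked_fuse_iff hP hX hU]
    constructor
    · intro hl b' hb'
      obtain ⟨b, hb⟩ := hUpart.nonempty e he
      exact mem_of_linked hP hJ.1 hC (heC hb) (hUpart.subset he' hb') (hl b hb b' hb')
    · intro he'C b hb b' hb'
      exact linked_of_mem_components hP hJ.1 hC (heC hb) (he'C hb')
  have hcomp : components (fuse X) (fuse U)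
      = (components P (U.sup id)).image fun C => fuse (U.filter (· ⊆ C)) := by
    ext c
    constructor
    · intro hc
      obtain ⟨g, hg, rfl⟩ := Finset.mem_image.1 hc
      obtain ⟨e, he, rfl⟩ := Finset.mem_image.1 hg
      obtain ⟨C, hC, heC⟩ := h e he
      exact Finset.mem_image.2 ⟨C, hC, (haux C hC e he heC).symm⟩
    · intro hc
      obtain ⟨C, hC, rfl⟩ := Finset.mem_image.1 hc
      obtain ⟨b, hb⟩ := hpart.nonempty C hC
      obtain ⟨e, he, hbe⟩ := hUpart.exists_mem (hpart.subset hC hb)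
      obtain ⟨C', hC', heC⟩ := h e he
      obtain rfl := hpart.eq_of_mem C hC C' hC' b hb (heC hbe)
      exact Finset.mem_image.2 ⟨_, Finset.mem_image_of_mem _ he, haux C hC e he heC⟩
  rw [ncMonomial, hcomp, Finset.prod_image]
  exact fuse_restrict_injOn (hP.mono hJ.1) hUpart hpart h

open Classical in
theorem separationSum_fuse (hP : IsBlockFamily P) (hX : IsSetPartition X P) :
    separationSum K (fuse X) = ∑ U ∈ X.powerset.filter (fun U => IsConvexIn P (U.sup id) ∧
        Refines U (components P (U.sup id))),
      ncGen K (fuse (X \ U)) ⊗ₜ[K]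
        ∏ C ∈ components P (U.sup id), ncGen K (fuse (U.filter (· ⊆ C))) := by
  have hinj : Set.InjOn ncGround (X : Set (Finset (Finset ℕ))) :=
    hP.ncGround_injOn.mono fun c hc => hX.subset hc
  symm
  refine Finset.sum_bij (fun U _ => fuse U) ?_ ?_ ?_ ?_
  · intro U hU
    rw [Finset.mem_filter, Finset.mem_powerset] at hU
    rw [mem_convexSubsets, isConvexIn_fuse_iff hP hX hU.1]
    exact hU.2
  · intro U hU V hV e
    rw [Finset.mem_filter, Finset.mem_powerset] at hU hV
    exact injOn_image_powerset hinj hU.1 hV.1 e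
  · intro I hI
    rw [mem_convexSubsets] at hI
    obtain ⟨U, hU, rfl⟩ := Finset.subset_image_iff.1 hI.1
    refine ⟨U, ?_, rfl⟩
    rw [Finset.mem_filter, Finset.mem_powerset]
    exact ⟨hU, (isConvexIn_fuse_iff hP hX hU).1 hI⟩
  · intro U hU
    rw [Finset.mem_filter, Finset.mem_powerset] at hU
    obtain ⟨hU, hJ, h⟩ := hU
    rw [ncMonomial_components_fuse K hP hX hU hJ h]
    congr 2
    ext g
    simp only [fuse, Finset.mem_sdiff, Finset.mem_image]
    constructor
    · rintro ⟨e, ⟨he, heU⟩, rfl⟩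
      refine ⟨⟨e, he, rfl⟩, fun ⟨e', he', h'⟩ => heU ?_⟩
      rwa [← hinj (hU he') he h']
    · rintro ⟨⟨e, he, rfl⟩, h'⟩
      exact ⟨e, ⟨he, fun heU => h' ⟨e, heU, rfl⟩⟩, rfl⟩

theorem IsSetPartition.sdiff {α : Type*} [DecidableEq α] {P : Finset α} {X U : Finset (Finset α)}
    (hX : IsSetPartition X P) (hU : U ⊆ X) : IsSetPartition (X \ U) (P \ U.sup id) := by
  refine ⟨fun c hc => hX.nonempty c (Finset.mem_sdiff.1 hc).1, fun a => ?_,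
    fun c hc d hd => hX.eq_of_mem c (Finset.mem_sdiff.1 hc).1 d (Finset.mem_sdiff.1 hd).1⟩
  simp only [Finset.mem_sdiff, Finset.mem_sup, id, hX.mem_iff]
  constructor
  · rintro ⟨⟨c, hc, ha⟩, h⟩
    exact ⟨c, ⟨hc, fun hcU => h ⟨c, hcU, ha⟩⟩, ha⟩
  · rintro ⟨c, ⟨hc, hcU⟩, ha⟩
    refine ⟨⟨c, hc, ha⟩, fun ⟨d, hd, had⟩ => hcU ?_⟩
    rwa [hX.eq_of_mem c hc d (hU hd) a ha had]

theorem IsSetPartition.sup_id {α : Type*} [DecidableEq α] {P : Finset α} {X : Finset (Finset α)}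
    (hX : IsSetPartition X P) : X.sup id = P := by
  ext a
  simp [Finset.mem_sup, hX.mem_iff]

theorem IsSetPartition.disjoint_sdiff {α : Type*} [DecidableEq α] {P J : Finset α}
    {Y Z : Finset (Finset α)} (hY : IsSetPartition Y (P \ J)) (hZ : IsSetPartition Z J) :
    Disjoint Z Y := by
  rw [Finset.disjoint_left]
  intro c hc hc'
  obtain ⟨a, ha⟩ := hZ.nonempty c hc
  exact (Finset.mem_sdiff.1 (hY.subset hc' ha)).2 (hZ.subset hc ha)

theorem IsSetPartition.union {α : Type*} [DecidableEq α] {P J : Finset α}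
    {Y Z : Finset (Finset α)} (hJ : J ⊆ P) (hY : IsSetPartition Y (P \ J))
    (hZ : IsSetPartition Z J) : IsSetPartition (Z ∪ Y) P := by
  refine ⟨fun c hc => ?_, fun a => ?_, fun c hc d hd a hac had => ?_⟩
  · rcases Finset.mem_union.1 hc with hc | hc
    exacts [hZ.nonempty c hc, hY.nonempty c hc]
  · constructor
    · intro ha
      by_cases haJ : a ∈ J
      · obtain ⟨c, hc, hac⟩ := hZ.exists_mem haJ
        exact ⟨c, Finset.mem_union_left _ hc, hac⟩
      · obtain ⟨c, hc, hac⟩ := hY.exists_mem (Finset.mem_sdiff.2 ⟨ha, haJ⟩)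
        exact ⟨c, Finset.mem_union_right _ hc, hac⟩
    · rintro ⟨c, hc, hac⟩
      rcases Finset.mem_union.1 hc with hc | hc
      exacts [hJ (hZ.subset hc hac), (Finset.mem_sdiff.1 (hY.subset hc hac)).1]
  · rcases Finset.mem_union.1 hc with hc | hc <;> rcases Finset.mem_union.1 hd with hd | hd
    · exact hZ.eq_of_mem c hc d hd a hac had
    · exact absurd (hZ.subset hc hac) (Finset.mem_sdiff.1 (hY.subset hd had)).2
    · exact absurd (hZ.subset hd had) (Finset.mem_sdiff.1 (hY.subset hc hac)).2
    · exact hY.eq_of_mem c hc d hd a hac had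

theorem ncDelta_ncFusionDelta_cointeraction :
    (Algebra.TensorProduct.map (ncDelta K) (AlgHom.id K _)).comp (ncFusionDelta K)
      = (mul1324 K (NCPAlgebra K)).comp
        ((Algebra.TensorProduct.map (ncFusionDelta K) (ncFusionDelta K)).comp (ncDelta K)) := by
  classical
  refine algHom_ext_ncGen K fun P hP _ => ?_
  replace hP := hP.isBlockFamily
  simp only [AlgHom.comp_apply, ncFusionDelta_ncGen K hP, ncDelta_ncGen K hP]
  rw [fusionSum, separationSum]
  simp only [map_sum, Algebra.TensorProduct.map_tmul, AlgHom.id_apply]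
  refine (Finset.sum_congr (g := fun X => ∑ U ∈ X.powerset.filter (fun U =>
      IsConvexIn P (U.sup id) ∧ Refines U (components P (U.sup id))),
      (ncGen K (fuse (X \ U)) ⊗ₜ[K]
        ∏ C ∈ components P (U.sup id), ncGen K (fuse (U.filter (· ⊆ C)))) ⊗ₜ[K]
        ncMonomial K X) rfl fun X hX => ?_).trans
    (Eq.trans ?_ (Finset.sum_congr (f := fun J =>
      ∑ p ∈ setPartitions (P \ J) ×ˢ refinements J (components P J),
      (ncGen K (fuse p.1) ⊗ₜ[K] ∏ C ∈ components P J, ncGen K (fuse (p.2.filter (· ⊆ C)))) ⊗ₜ[K]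
        (ncMonomial K p.1 * ncMonomial K p.2)) rfl fun J hJ => ?_))
  · rw [mem_setPartitions] at hX
    rw [ncDelta_ncGen K (isBlockFamily_fuse hP hX), separationSum_fuse K hP hX,
      TensorProduct.sum_tmul]
  · rw [Finset.sum_sigma', Finset.sum_sigma']
    -- The classes in `U` partition the separated set `J`, and the remaining classes partition `P \
    -- J`.
    refine Finset.sum_bij' (fun p _ => ⟨p.2.sup id, (p.1 \ p.2, p.2)⟩)
      (fun p _ => ⟨p.2.2 ∪ p.2.1, p.2.2⟩) ?_ ?_ ?_ ?_ ?_
    · rintro ⟨X, U⟩ h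
      simp only [Finset.mem_sigma, Finset.mem_filter, Finset.mem_powerset, mem_convexSubsets,
        Finset.mem_product, mem_setPartitions, mem_refinements] at h ⊢
      exact ⟨h.2.2.1, h.1.sdiff h.2.1, h.1.mono_sup h.2.1, h.2.2.2⟩
    · rintro ⟨J, Y, Z⟩ h
      simp only [Finset.mem_sigma, Finset.mem_filter, Finset.mem_powerset, mem_convexSubsets,
        Finset.mem_product, mem_setPartitions, mem_refinements] at h ⊢
      obtain ⟨hJ, hY, hZ, h⟩ := h
      rw [hZ.sup_id]
      exact ⟨IsSetPartition.union hJ.1 hY hZ, Finset.subset_union_left, hJ, h⟩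
    · rintro ⟨X, U⟩ h
      simp only [Finset.mem_sigma, Finset.mem_filter, Finset.mem_powerset] at h
      simp [Finset.union_sdiff_of_subset h.2.1]
    · rintro ⟨J, Y, Z⟩ h
      simp only [Finset.mem_sigma, Finset.mem_product, mem_setPartitions, mem_refinements] at h
      obtain ⟨hJ, hY, hZ, h⟩ := h
      simp only [hZ.sup_id, Finset.union_sdiff_cancel_left (hY.disjoint_sdiff hZ)]
    · rintro ⟨X, U⟩ h
      simp only [Finset.mem_sigma, Finset.mem_filter, Finset.mem_powerset] at h
      simp only [ncMonomial, Finset.prod_sdiff h.2.1]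
  · rw [mem_convexSubsets] at hJ
    rw [ncFusionDelta_ncGen K (hP.mono Finset.sdiff_subset), ncFusionDelta_ncMonomial K
      (hP.mono hJ.1) (isSetPartition_components hP hJ), fusionSum, TensorProduct.sum_tmul,
      map_sum, Finset.sum_product]
    refine Finset.sum_congr rfl fun Y _ => ?_
    rw [TensorProduct.tmul_sum, map_sum]
    exact Finset.sum_congr rfl fun Z _ => (mul1324_tmul _ _ _ _).symm

end Fusion

/-! ### Counits -/

section Counit

variable (K : Type*) [Field K]

theorem ncDeltaCounit_ncGen {P : Finset (Finset ℕ)} (h : P.Nonempty) :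
    ncDeltaCounit K (ncGen K P) = 0 := by
  by_cases hP : IsNCPartition P (ncGround P)
  · rw [ncGen_eq_X K hP h, ncDeltaCounit, MvPolynomial.aeval_X]
  · rw [ncGen_eq_zero K hP, map_zero]

theorem ncFusionCounit_ncGen {P : Finset (Finset ℕ)} (h : P.Nonempty) (h1 : P.card ≠ 1) :
    ncFusionCounit K (ncGen K P) = 0 := by
  by_cases hP : IsNCPartition P (ncGround P)
  · rw [ncGen_eq_X K hP h, ncFusionCounit, MvPolynomial.aeval_X, if_neg]
    exact fun e => h1
      ((Finset.card_image_of_injOn (injOn_image_blocks (ncRank_injOn _))).symm.trans e)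
  · rw [ncGen_eq_zero K hP, map_zero]

theorem ncFusionCounit_ncGen_singleton {b : Finset ℕ} (hb : b.Nonempty) :
    ncFusionCounit K (ncGen K {b}) = 1 := by
  have hP : IsNCPartition {b} (ncGround {b}) :=
    ⟨by simpa using hb, by simp, rfl, by simp⟩
  rw [ncGen_eq_X K hP (Finset.singleton_nonempty b), ncFusionCounit, MvPolynomial.aeval_X, if_pos]
  simp [ncStd]

theorem nonempty_of_isSetPartition {α : Type*} {P : Finset α} {X : Finset (Finset α)}
    (hX : IsSetPartition X P) (h : P.Nonempty) : X.Nonempty := by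
  obtain ⟨a, ha⟩ := h
  obtain ⟨c, hc, -⟩ := hX.exists_mem ha
  exact ⟨c, hc⟩

theorem components_self {P : Finset (Finset ℕ)} (h : P.Nonempty) : components P P = {P} := by
  classical
  obtain ⟨b, hb⟩ := h
  have : ∀ b, P.filter (Linked P P b) = P := fun b =>
    Finset.filter_true_of_mem fun b' _ x _ y _ c hc _ _ _ => hc
  ext C
  simp only [components, this, Finset.mem_image, Finset.mem_singleton]
  exact ⟨fun ⟨_, _, e⟩ => e.symm, fun e => ⟨b, hb, e.symm⟩⟩

theorem isConvexIn_self (P : Finset (Finset ℕ)) : IsConvexIn P P :=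
  ⟨subset_rfl, fun _ _ _ _ _ _ _ hc _ _ _ => hc⟩

theorem isConvexIn_empty (P : Finset (Finset ℕ)) : IsConvexIn P ∅ :=
  ⟨Finset.empty_subset P, by simp⟩

theorem ncDelta_counit_left : (Algebra.TensorProduct.map (ncDeltaCounit K) (AlgHom.id K _)).comp
    (ncDelta K) = (Algebra.TensorProduct.lid K (NCPAlgebra K)).symm := by
  refine algHom_ext_ncGen K fun P hP hne => ?_
  simp only [AlgHom.comp_apply, ncDelta_ncGen K hP.isBlockFamily]
  -- Only `J = P` survives: otherwise `P \ J` is nonempty and killed by the counit.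
  rw [separationSum, map_sum, Finset.sum_eq_single P]
  · rw [Finset.sdiff_self, components_self hne, ncGen_empty, Algebra.TensorProduct.map_tmul,
      map_one, ncMonomial, Finset.prod_singleton]
    rfl
  · intro J hJ hJP
    rw [mem_convexSubsets] at hJ
    rw [Algebra.TensorProduct.map_tmul, ncDeltaCounit_ncGen, TensorProduct.zero_tmul]
    exact Finset.sdiff_nonempty.2 fun h => hJP (hJ.1.antisymm h)
  · exact fun h => absurd (mem_convexSubsets.2 (isConvexIn_self P)) h

theorem ncDelta_counit_right : (Algebra.TensorProduct.map (AlgHom.id K _) (ncDeltaCounit K)).comp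
    (ncDelta K) = (Algebra.TensorProduct.rid K K (NCPAlgebra K)).symm := by
  refine algHom_ext_ncGen K fun P hP hne => ?_
  simp only [AlgHom.comp_apply, ncDelta_ncGen K hP.isBlockFamily]
  rw [separationSum, map_sum, Finset.sum_eq_single ∅]
  · rw [Finset.sdiff_empty, components_empty, Algebra.TensorProduct.map_tmul, ncMonomial,
      Finset.prod_empty, map_one]
    rfl
  · intro J hJ hJP
    rw [mem_convexSubsets] at hJ
    have hpart := isSetPartition_components hP.isBlockFamily hJ
    obtain ⟨C, hC⟩ := nonempty_of_isSetPartition hpart (Finset.nonempty_iff_ne_empty.2 hJP)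
    rw [Algebra.TensorProduct.map_tmul, ncMonomial, map_prod, Finset.prod_eq_zero hC,
      TensorProduct.tmul_zero]
    exact ncDeltaCounit_ncGen K (hpart.nonempty C hC)
  · exact fun h => absurd (mem_convexSubsets.2 (isConvexIn_empty P)) h

theorem isSetPartition_singleton {α : Type*} {P : Finset α} (h : P.Nonempty) :
    IsSetPartition {P} P :=
  ⟨by simpa using h, by simp, by simp⟩

theorem isSetPartition_singletons {α : Type*} [DecidableEq α] (P : Finset α) :
    IsSetPartition (P.image fun b => {b}) P :=
  ⟨by simp, by simp, by
    simp only [Finset.forall_mem_image, Finset.mem_singleton]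
    rintro b _ c _ a rfl rfl
    rfl⟩

/-- The surviving term is the partition with a single class, the only one whose fusion has one
block. -/
theorem ncFusionDelta_counit_left :
    (Algebra.TensorProduct.map (ncFusionCounit K) (AlgHom.id K _)).comp (ncFusionDelta K)
      = (Algebra.TensorProduct.lid K (NCPAlgebra K)).symm := by
  refine algHom_ext_ncGen K fun P hP hne => ?_
  have hB := hP.isBlockFamily
  simp only [AlgHom.comp_apply, ncFusionDelta_ncGen K hB]
  rw [fusionSum, map_sum, Finset.sum_eq_single {P}]
  · rw [Algebra.TensorProduct.map_tmul, fuse, Finset.image_singleton,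
      ncFusionCounit_ncGen_singleton, ncMonomial, Finset.prod_singleton]
    · rfl
    · obtain ⟨b, hb⟩ := hne
      exact (hB.nonempty b hb).mono (subset_ncGround hb)
  · intro X hX hXP
    rw [mem_setPartitions] at hX
    have hXne := nonempty_of_isSetPartition hX hne
    rw [Algebra.TensorProduct.map_tmul, ncFusionCounit_ncGen K (P := fuse X) (hXne.image _),
      TensorProduct.zero_tmul]
    rw [fuse, Finset.card_image_of_injOn (hB.ncGround_injOn.mono fun c hc => hX.subset hc)]
    intro h1
    obtain ⟨c, rfl⟩ := Finset.card_eq_one.1 h1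
    exact hXP (by rw [← hX.sup_id, Finset.sup_singleton, id])
  · exact fun h => absurd (mem_setPartitions.2 (isSetPartition_singleton hne)) h

/-- The surviving term is the partition into singletons, the only one all of whose classes have one
block. -/
theorem ncFusionDelta_counit_right :
    (Algebra.TensorProduct.map (AlgHom.id K _) (ncFusionCounit K)).comp (ncFusionDelta K)
      = (Algebra.TensorProduct.rid K K (NCPAlgebra K)).symm := by
  refine algHom_ext_ncGen K fun P hP hne => ?_
  have hB := hP.isBlockFamily
  simp only [AlgHom.comp_apply, ncFusionDelta_ncGen K hB]
  rw [fusionSum, map_sum, Finset.sum_eq_single (P.image fun b => {b})]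
  · have hfuse : fuse (P.image fun b => {b}) = P := by
      rw [fuse, Finset.image_image]
      conv_rhs => rw [← Finset.image_id (s := P)]
      exact Finset.image_congr fun b _ => by simp [ncGround]
    rw [Algebra.TensorProduct.map_tmul, hfuse, ncMonomial, map_prod, Finset.prod_eq_one]
    · rfl
    · simp only [Finset.forall_mem_image]
      exact fun b hb => ncFusionCounit_ncGen_singleton K (hB.nonempty b hb)
  · intro X hX hXP
    rw [mem_setPartitions] at hX
    have : ∃ c ∈ X, c.card ≠ 1 := by
      by_contra! hcard
      refine hXP ?_
      ext c
      simp only [Finset.mem_image]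
      constructor
      · intro hc
        obtain ⟨b, rfl⟩ := Finset.card_eq_one.1 (hcard c hc)
        exact ⟨b, hX.subset hc (Finset.mem_singleton_self b), rfl⟩
      · rintro ⟨b, hb, rfl⟩
        obtain ⟨c, hc, hbc⟩ := hX.exists_mem hb
        obtain ⟨b', rfl⟩ := Finset.card_eq_one.1 (hcard c hc)
        rwa [Finset.mem_singleton.1 hbc]
    obtain ⟨c, hc, h1⟩ := this
    rw [Algebra.TensorProduct.map_tmul, ncMonomial, map_prod, Finset.prod_eq_zero hc,
      TensorProduct.tmul_zero]
    exact ncFusionCounit_ncGen K (hX.nonempty c hc) h1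
  · exact fun h => absurd (mem_setPartitions.2 (isSetPartition_singletons P)) h

/-- Fusing a nonempty family leaves at least one block, so the counit kills every term. -/
theorem ncDeltaCounit_coaction (x : NCPAlgebra K) :
    Algebra.TensorProduct.lid K (NCPAlgebra K) (Algebra.TensorProduct.map (ncDeltaCounit K)
      (AlgHom.id K _) (ncFusionDelta K x)) = algebraMap K (NCPAlgebra K) (ncDeltaCounit K x) := by
  suffices h : (Algebra.TensorProduct.lid K (NCPAlgebra K)).toAlgHom.comp
      ((Algebra.TensorProduct.map (ncDeltaCounit K) (AlgHom.id K _)).comp (ncFusionDelta K))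
      = (Algebra.ofId K (NCPAlgebra K)).comp (ncDeltaCounit K) from DFunLike.congr_fun h x
  refine algHom_ext_ncGen K fun P hP hne => ?_
  simp only [AlgHom.comp_apply, ncFusionDelta_ncGen K hP.isBlockFamily]
  rw [ncDeltaCounit_ncGen K hne, fusionSum, map_sum, Finset.sum_eq_zero, map_zero, map_zero]
  intro X hX
  rw [mem_setPartitions] at hX
  rw [Algebra.TensorProduct.map_tmul,
    ncDeltaCounit_ncGen K (P := fuse X) ((nonempty_of_isSetPartition hX hne).image _), TensorProduct.zero_tmul]

end Counit

end

/-! ### The double bialgebra structure -/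

theorem proposition2p10 (K : Type*) [Field K] :
    IsDoubleBialgebra (ncDelta K) (ncFusionDelta K) (ncDeltaCounit K) (ncFusionCounit K) where
  bialgebra_left := ⟨ncDelta_coassoc K, ncDelta_counit_left K, ncDelta_counit_right K⟩
  bialgebra_right :=
    ⟨ncFusionDelta_coassoc K, ncFusionDelta_counit_left K, ncFusionDelta_counit_right K⟩
  counit_coaction := ncDeltaCounit_coaction K
  cointeraction := ncDelta_ncFusionDelta_cointeraction K
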